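/- Let $E$ be a complex Banach lattice, i.e. the complexification of a real Banach lattice, with positive cone $E_+$. Let $(P_n)_{n\in\mathbb N}$ be a sequence of positive linear operators on $E$ (positive: $P_nE_+\subseteq E_+$) that is increasing (each $P_{n+1}-P_n$ is positive) and converges strongly to the identity. Let $(e^{tA})_{t\ge 0}$ be a $C_0$-semigroup on $E$ with generator $A$ that is locally eventually positive (LEP) with respect to $(P_n)$: for every $n\in\mathbb N$ and every $f\in E_+\setminus\{0\}$ there exists $\tau>0$ (depending on $n$ and $f$) such that $P_n e^{tA}f\ge 0$ for all $t\ge\tau$. Let $s(A):=\sup\{\operatorname{Re}\lambda:\lambda\in\sigma(A)\}\in[-\infty,\infty]$ be the spectral bound, let $\sigma_{\mathrm{ess}}(A)$ be the set of all $\lambda\in\mathbb C$ for which $A-\lambda I$ is not Fredholm (Fredholm: $\dim\ker(A-\lambda I)<\infty$ and $\operatorname{codim}\operatorname{rg}(A-\lambda I)<\infty$), and let $s_{\mathrm{ess}}(A):=\sup\{\operatorname{Re}\lambda:\lambda\in\sigma_{\mathrm{ess}}(A)\}\in[-\infty,\infty]$, where $\sup\emptyset=-\infty$. **Theorem.** If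 $s_{\mathrm{ess}}(A)<s(A)$, then $s(A)$ is finite and the following assertions hold. (i) $s(A)$ is a pole of the resolvent $R(\cdot,A)=(\,\cdot\,-A)^{-1}$ of some order $m\ge 1$, and $s(A)$ is an eigenvalue of $A$ with a positive eigenvector, i.e. there is $v\in D(A)\cap E_+$, $v\neq 0$, with $Av=s(A)v$. (ii) Every pole of $R(\cdot,A)$ in the peripheral spectrum $\{\lambda\in\sigma(A):\operatorname{Re}\lambda=s(A)\}$ has order at most $m$. -/

import Mathlib

open Filter Topology

noncomputable section

/-! ### Complex Banach lattices -/

/-- The algebraic complexification `F + iF` of a real vector space `F`. -/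
@[ext]
structure Complexification (F : Type*) where
  /-- real part -/
  re : F
  /-- imaginary part -/
  im : F

namespace Complexification

section Algebra

variable {F : Type*} [AddCommGroup F]

instance : Zero (Complexification F) := ⟨⟨0, 0⟩⟩
instance : Add (Complexification F) := ⟨fun z w => ⟨z.re + w.re, z.im + w.im⟩⟩
instance : Neg (Complexification F) := ⟨fun z => ⟨-z.re, -z.im⟩⟩
instance : Sub (Complexification F) := ⟨fun z w => ⟨z.re - w.re, z.im - w.im⟩⟩

@[simp] theorem zero_re : (0 : Complexification F).re = 0 := rfl
@[simp] theorem zero_im : (0 : Complexification F).im = 0 := rfl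
@[simp] theorem add_re (z w : Complexification F) : (z + w).re = z.re + w.re := rfl
@[simp] theorem add_im (z w : Complexification F) : (z + w).im = z.im + w.im := rfl
@[simp] theorem neg_re (z : Complexification F) : (-z).re = -z.re := rfl
@[simp] theorem neg_im (z : Complexification F) : (-z).im = -z.im := rfl
@[simp] theorem sub_re (z w : Complexification F) : (z - w).re = z.re - w.re := rfl
@[simp] theorem sub_im (z w : Complexification F) : (z - w).im = z.im - w.im := rfl

instance : AddCommGroup (Complexification F) where
  add_assoc a b c := by ext <;> simp [add_assoc]
  zero_add a := by ext <;> simp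
  add_zero a := by ext <;> simp
  add_comm a b := by ext <;> simp [add_comm]
  neg_add_cancel a := by ext <;> simp
  sub_eq_add_neg a b := by ext <;> simp [sub_eq_add_neg]
  nsmul := nsmulRec
  zsmul := zsmulRec

variable [Module ℝ F]

instance : SMul ℂ (Complexification F) :=
  ⟨fun c z => ⟨c.re • z.re - c.im • z.im, c.re • z.im + c.im • z.re⟩⟩

@[simp] theorem smul_re (c : ℂ) (z : Complexification F) :
    (c • z).re = c.re • z.re - c.im • z.im := rfl
@[simp] theorem smul_im (c : ℂ) (z : Complexification F) :
    (c • z).im = c.re • z.im + c.im • z.re := rfl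

instance : Module ℂ (Complexification F) where
  one_smul z := by ext <;> simp
  mul_smul c d z := by ext <;> simp <;> module
  smul_zero c := by ext <;> simp
  smul_add c z w := by ext <;> simp <;> module
  add_smul c d z := by ext <;> simp <;> module
  zero_smul z := by ext <;> simp

end Algebra

section Modulus

variable {F : Type*} [NormedAddCommGroup F] [Lattice F] [HasSolidNorm F] [IsOrderedAddMonoid F]
  [NormedSpace ℝ F] [IsOrderedModule ℝ F]

/-- The set `{Re (e^{iθ} z) : θ ∈ ℝ}` in the real lattice. -/
def rotations (z : Complexification F) : Set F :=
  {x | ∃ c : ℂ, ‖c‖ = 1 ∧ (c • z).re = x}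

theorem cmp_smul {r s : ℝ} (h : |r| ≤ s) (x : F) : r • x ≤ s • |x| := by
  have hs : 0 ≤ s := (abs_nonneg r).trans h
  rcases le_total 0 r with hr | hr
  · rw [abs_of_nonneg hr] at h
    exact (smul_le_smul_of_nonneg_left (le_abs_self x) hr).trans
      (smul_le_smul_of_nonneg_right h (abs_nonneg x))
  · rw [abs_of_nonpos hr] at h
    have : r • x = (-r) • (-x) := by simp
    rw [this]
    exact (smul_le_smul_of_nonneg_left (neg_le_abs x) (by linarith)).trans
      (smul_le_smul_of_nonneg_right h (abs_nonneg x))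

/-- In a Banach lattice, the supremum `sup_θ Re (e^{iθ} z)` exists. -/
theorem exists_isLUB_rotations [CompleteSpace F] (z : Complexification F) :
    ∃ m, IsLUB (rotations z) m := by
  classical
  set w : F := |z.re| + |z.im| with hw
  have hw0 : 0 ≤ w := add_nonneg (abs_nonneg _) (abs_nonneg _)
  have hlip : ∀ c d : ℂ, (c • z).re ≤ (d • z).re + ‖c - d‖ • w := by
    intro c d
    have h1 := cmp_smul (r := (c - d).re) (s := ‖c - d‖) (Complex.abs_re_le_norm _) z.re
    have h2 := cmp_smul (r := -(c - d).im) (s := ‖c - d‖)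
      (by rw [abs_neg]; exact Complex.abs_im_le_norm _) z.im
    have h3 : (c • z).re = (d • z).re + ((c - d).re • z.re + (-(c - d).im) • z.im) := by
      simp; module
    rw [h3, hw, smul_add]
    gcongr
  have hcomp : IsCompact (Metric.sphere (0 : ℂ) 1) := isCompact_sphere 0 1
  have hnet : ∀ n : ℕ, ∃ t : Finset ℂ, t.Nonempty ∧ (∀ c ∈ t, ‖c‖ = 1) ∧
      ∀ c : ℂ, ‖c‖ = 1 → ∃ d ∈ t, ‖c - d‖ ≤ (1 / 2 : ℝ) ^ n := by
    intro n
    obtain ⟨t, hts, htf, hcov⟩ := hcomp.finite_cover_balls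
      (show (0 : ℝ) < (1 / 2 : ℝ) ^ n by positivity)
    have key : ∀ c : ℂ, ‖c‖ = 1 → ∃ d ∈ htf.toFinset, ‖c - d‖ ≤ (1 / 2 : ℝ) ^ n := by
      intro c hc
      obtain ⟨d, hd, hcd⟩ := Set.mem_iUnion₂.1 (hcov (by simpa using hc))
      exact ⟨d, by simpa using hd, by rw [← dist_eq_norm]; exact (Metric.mem_ball.1 hcd).le⟩
    obtain ⟨d, hd, -⟩ := key 1 (by simp)
    exact ⟨htf.toFinset, ⟨d, hd⟩, fun c hc => by simpa using hts (by simpa using hc), key⟩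
  choose t htne ht1 htnet using hnet
  let m : ℕ → F := fun n => (t n).sup' (htne n) (fun c => (c • z).re)
  have hle : ∀ n (c : ℂ), ‖c‖ = 1 → (c • z).re ≤ m n + ((1 / 2 : ℝ) ^ n) • w := by
    intro n c hc
    obtain ⟨d, hd, hcd⟩ := htnet n c hc
    exact (hlip c d).trans (add_le_add (Finset.le_sup' (fun c : ℂ => (c • z).re) hd)
      (smul_le_smul_of_nonneg_right hcd hw0))
  have hmm : ∀ k n, m k ≤ m n + ((1 / 2 : ℝ) ^ n) • w := fun k n =>
    Finset.sup'_le _ _ fun c hc => hle n c (ht1 k c hc)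
  have hdist : ∀ n k N : ℕ, N ≤ n → N ≤ k → dist (m n) (m k) ≤ (1 / 2 : ℝ) ^ N * ‖w‖ := by
    intro n k N hn hk
    have hmono : ∀ j, N ≤ j → ((1 / 2 : ℝ) ^ j) • w ≤ ((1 / 2 : ℝ) ^ N) • w := fun j hj =>
      smul_le_smul_of_nonneg_right
        (pow_le_pow_of_le_one (by norm_num) (by norm_num) hj) hw0
    have h0 : 0 ≤ ((1 / 2 : ℝ) ^ N) • w := smul_nonneg (by positivity) hw0
    have habs : |m n - m k| ≤ |((1 / 2 : ℝ) ^ N) • w| := by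
      rw [abs_of_nonneg h0]
      refine abs_le'.2 ⟨?_, ?_⟩
      · rw [sub_le_iff_le_add']
        exact (hmm n k).trans (add_le_add le_rfl (hmono k hk))
      · rw [neg_sub, sub_le_iff_le_add']
        exact (hmm k n).trans (add_le_add le_rfl (hmono n hn))
    rw [dist_eq_norm]
    refine (norm_le_norm_of_abs_le_abs habs).trans_eq ?_
    rw [norm_smul, Real.norm_of_nonneg (by positivity)]
  have hpow : Tendsto (fun n : ℕ => (1 / 2 : ℝ) ^ n) atTop (𝓝 0) :=
    tendsto_pow_atTop_nhds_zero_of_lt_one (by norm_num) (by norm_num)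
  have hcau : CauchySeq m := cauchySeq_of_le_tendsto_0 (fun N => (1 / 2 : ℝ) ^ N * ‖w‖)
    hdist (by simpa using hpow.mul_const ‖w‖)
  obtain ⟨l, hl⟩ := cauchySeq_tendsto_of_complete hcau
  refine ⟨l, ?_, ?_⟩
  · rintro x ⟨c, hc, rfl⟩
    have h : Tendsto (fun n => m n + ((1 / 2 : ℝ) ^ n) • w) atTop (𝓝 (l + (0 : ℝ) • w)) :=
      hl.add (hpow.smul_const w)
    rw [zero_smul, add_zero] at h
    exact ge_of_tendsto' h fun n => hle n c hc
  · intro u hu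
    exact le_of_tendsto' hl fun n => Finset.sup'_le _ _ fun c hc => hu ⟨c, ht1 n c hc, rfl⟩

variable [CompleteSpace F]

/-- The modulus `|z| = sup_θ Re (e^{iθ} z)`. -/
def modulus (z : Complexification F) : F := (exists_isLUB_rotations z).choose

theorem isLUB_modulus (z : Complexification F) : IsLUB (rotations z) (modulus z) :=
  (exists_isLUB_rotations z).choose_spec

theorem re_smul_le_modulus (z : Complexification F) {c : ℂ} (hc : ‖c‖ = 1) :
    (c • z).re ≤ modulus z := (isLUB_modulus z).1 ⟨c, hc, rfl⟩

theorem modulus_le {z : Complexification F} {u : F} (h : ∀ c : ℂ, ‖c‖ = 1 → (c • z).re ≤ u) :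
    modulus z ≤ u := (isLUB_modulus z).2 (by rintro x ⟨c, hc, rfl⟩; exact h c hc)

theorem abs_re_le_modulus (z : Complexification F) : |z.re| ≤ modulus z := by
  refine abs_le'.2 ⟨?_, ?_⟩
  · simpa using re_smul_le_modulus z (c := 1) (by simp)
  · simpa using re_smul_le_modulus z (c := -1) (by simp)

theorem abs_im_le_modulus (z : Complexification F) : |z.im| ≤ modulus z := by
  refine abs_le'.2 ⟨?_, ?_⟩
  · simpa using re_smul_le_modulus z (c := -Complex.I) (by simp)
  · simpa using re_smul_le_modulus z (c := Complex.I) (by simp)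

theorem modulus_nonneg (z : Complexification F) : 0 ≤ modulus z :=
  (abs_nonneg _).trans (abs_re_le_modulus z)

theorem modulus_add_le (z w : Complexification F) : modulus (z + w) ≤ modulus z + modulus w :=
  modulus_le fun c hc => by
    rw [smul_add, add_re]
    exact add_le_add (re_smul_le_modulus z hc) (re_smul_le_modulus w hc)

theorem modulus_smul_le (d : ℂ) (z : Complexification F) : modulus (d • z) ≤ ‖d‖ • modulus z := by
  refine modulus_le fun c hc => ?_
  by_cases hd : d = 0
  · simp [hd]
  have hd' : (‖d‖ : ℂ) ≠ 0 := by simpa using hd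
  have h1 : c • d • z = (‖d‖ : ℂ) • ((c * d / ‖d‖) • z) := by
    rw [smul_smul, smul_smul, mul_div_cancel₀ _ hd']
  rw [h1, smul_re]
  simp only [Complex.ofReal_re, Complex.ofReal_im, zero_smul, sub_zero]
  refine smul_le_smul_of_nonneg_left (re_smul_le_modulus z ?_) (norm_nonneg d)
  have : ‖d‖ ≠ 0 := by simpa using hd
  simp [hc, this]

/-- The lattice norm `‖z‖ = ‖|z|‖` of the complexification of a Banach lattice. -/
instance : Norm (Complexification F) := ⟨fun z => ‖modulus z‖⟩

theorem norm_def (z : Complexification F) : ‖z‖ = ‖modulus z‖ := rfl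

theorem norm_mono {x y : F} (hx : 0 ≤ x) (h : x ≤ y) : ‖x‖ ≤ ‖y‖ :=
  norm_le_norm_of_abs_le_abs (by rwa [abs_of_nonneg hx, abs_of_nonneg (hx.trans h)])

theorem norm_smul_le' (d : ℂ) (z : Complexification F) : ‖d • z‖ ≤ ‖d‖ * ‖z‖ := by
  have := norm_mono (modulus_nonneg _) (modulus_smul_le d z)
  rwa [norm_smul, norm_norm] at this

theorem norm_re_le (z : Complexification F) : ‖z.re‖ ≤ ‖z‖ :=
  norm_le_norm_of_abs_le_abs (by
    rw [abs_of_nonneg (modulus_nonneg z)]; exact abs_re_le_modulus z)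

theorem norm_im_le (z : Complexification F) : ‖z.im‖ ≤ ‖z‖ :=
  norm_le_norm_of_abs_le_abs (by
    rw [abs_of_nonneg (modulus_nonneg z)]; exact abs_im_le_modulus z)

instance : NormedAddCommGroup (Complexification F) :=
  AddGroupNorm.toNormedAddCommGroup
    { toFun := fun z => ‖z‖
      map_zero' := by
        have h := norm_smul_le' (0 : ℂ) (0 : Complexification F)
        rw [zero_smul, norm_zero, zero_mul] at h
        exact le_antisymm h (norm_nonneg (modulus (0 : Complexification F)))
      add_le' := fun z w =>
        (norm_mono (modulus_nonneg _) (modulus_add_le z w)).trans (norm_add_le _ _)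
      neg' := fun z => by
        have key : ∀ z : Complexification F, ‖-z‖ ≤ ‖z‖ := fun z => by
          have h := norm_smul_le' (-1 : ℂ) z
          simpa using h
        exact le_antisymm (key z) (by simpa using key (-z))
      eq_zero_of_map_eq_zero' := fun z hz => by
        ext
        · exact norm_le_zero_iff.1 ((norm_re_le z).trans_eq hz)
        · exact norm_le_zero_iff.1 ((norm_im_le z).trans_eq hz) }

instance : NormedSpace ℂ (Complexification F) where
  norm_smul_le := norm_smul_le'

theorem norm_le_add (z : Complexification F) : ‖z‖ ≤ ‖z.re‖ + ‖z.im‖ := by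
  have h : modulus z ≤ |z.re| + |z.im| := modulus_le fun c hc => by
    have h1 := cmp_smul (r := c.re) (s := 1) (by rw [← hc]; exact Complex.abs_re_le_norm c) z.re
    have h2 := cmp_smul (r := -c.im) (s := 1)
      (by rw [← hc, abs_neg]; exact Complex.abs_im_le_norm c) z.im
    rw [one_smul] at h1 h2
    rw [smul_re, sub_eq_add_neg, ← neg_smul]
    exact add_le_add h1 h2
  have h3 := (norm_mono (modulus_nonneg z) h).trans (norm_add_le _ _)
  rwa [norm_abs_eq_norm, norm_abs_eq_norm] at h3

instance : CompleteSpace (Complexification F) := by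
  refine Metric.complete_of_cauchySeq_tendsto fun u hu => ?_
  have hre : CauchySeq fun n => (u n).re := by
    rw [Metric.cauchySeq_iff] at hu ⊢
    intro ε hε
    obtain ⟨N, hN⟩ := hu ε hε
    refine ⟨N, fun m hm n hn => lt_of_le_of_lt ?_ (hN m hm n hn)⟩
    rw [dist_eq_norm, dist_eq_norm]
    exact norm_re_le (u m - u n)
  have him : CauchySeq fun n => (u n).im := by
    rw [Metric.cauchySeq_iff] at hu ⊢
    intro ε hε
    obtain ⟨N, hN⟩ := hu ε hε
    refine ⟨N, fun m hm n hn => lt_of_le_of_lt ?_ (hN m hm n hn)⟩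
    rw [dist_eq_norm, dist_eq_norm]
    exact norm_im_le (u m - u n)
  obtain ⟨a, ha⟩ := cauchySeq_tendsto_of_complete hre
  obtain ⟨b, hb⟩ := cauchySeq_tendsto_of_complete him
  refine ⟨⟨a, b⟩, tendsto_iff_norm_sub_tendsto_zero.2 ?_⟩
  refine squeeze_zero (fun n => norm_nonneg _) (fun n => norm_le_add _) ?_
  have h := (tendsto_iff_norm_sub_tendsto_zero.1 ha).add (tendsto_iff_norm_sub_tendsto_zero.1 hb)
  simpa using h

/-- The positive cone `E₊` of a complex Banach lattice `E`: the positive elements of its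
real part. -/
def positiveCone (F : Type*) [AddCommGroup F] [Lattice F] : Set (Complexification F) :=
  {z | 0 ≤ z.re ∧ z.im = 0}

/-- A linear operator `S` on a complex Banach lattice `E` is positive if `S (E₊) ⊆ E₊`. -/
def IsPositiveOperator (S : Complexification F →ₗ[ℂ] Complexification F) : Prop :=
  ∀ f ∈ positiveCone F, S f ∈ positiveCone F

/-- `(Pₙ)` is an increasing sequence of positive operators converging strongly to the identity. -/
structure IsPositiveApproximation (P : ℕ → Complexification F →ₗ[ℂ] Complexification F) :
    Prop where
  positive : ∀ n, IsPositiveOperator (P n)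
  increasing : ∀ n, IsPositiveOperator (P (n + 1) - P n)
  tendsto_id : ∀ f, Tendsto (fun n => P n f) atTop (𝓝 f)

end Modulus

end Complexification

/-! ### Unbounded operators: spectrum, resolvent, poles, essential spectrum -/

namespace UnboundedOperator

variable {E : Type*} [NormedAddCommGroup E] [NormedSpace ℂ E]

/-- The map `l - A : D(A) → E`. -/
def scalarSub (A : E →ₗ.[ℂ] E) (l : ℂ) : A.domain →ₗ[ℂ] E :=
  l • A.domain.subtype - A.toFun

/-- `R` is a bounded everywhere defined two-sided inverse of `l - A : D(A) → E`. -/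
def IsResolventAt (A : E →ₗ.[ℂ] E) (l : ℂ) (R : E →L[ℂ] E) : Prop :=
  (∀ x : A.domain, R (scalarSub A l x) = x) ∧
    ∀ y : E, ∃ x : A.domain, (x : E) = R y ∧ scalarSub A l x = y

/-- The resolvent set of `A`. -/
def resolventSet (A : E →ₗ.[ℂ] E) : Set ℂ := {l | ∃ R, IsResolventAt A l R}

/-- The spectrum of `A`. -/
def spectrum (A : E →ₗ.[ℂ] E) : Set ℂ := (resolventSet A)ᶜ

open Classical in
/-- The resolvent `R(l, A) = (l - A)⁻¹` for `l` in the resolvent set (and `0` elsewhere). -/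
def resolvent (A : E →ₗ.[ℂ] E) (l : ℂ) : E →L[ℂ] E :=
  if h : ∃ R, IsResolventAt A l R then h.choose else 0

/-- `l₀` is a pole of order `k ≥ 1` of the resolvent of `A`: an isolated point of the spectrum
at which `R(·, A)` has a pole of order `k` in the operator norm. -/
def IsResolventPole (A : E →ₗ.[ℂ] E) (l₀ : ℂ) (k : ℕ) : Prop :=
  1 ≤ k ∧ l₀ ∈ spectrum A ∧ (∀ᶠ l in 𝓝[≠] l₀, l ∈ resolventSet A) ∧
    meromorphicOrderAt (resolvent A) l₀ = ((-(k : ℤ) : ℤ) : WithTop ℤ)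

/-- The spectral bound `s(A) ∈ [-∞, ∞]`. -/
def spectralBound (A : E →ₗ.[ℂ] E) : EReal := ⨆ l ∈ spectrum A, ((l.re : ℝ) : EReal)

/-- The peripheral spectrum: the spectral values with real part `s(A)`. -/
def peripheralSpectrum (A : E →ₗ.[ℂ] E) : Set ℂ :=
  {l ∈ spectrum A | ((l.re : ℝ) : EReal) = spectralBound A}

/-- `A - l` (equivalently `l - A`) is Fredholm: finite nullity and finite deficiency. -/
def IsFredholmAt (A : E →ₗ.[ℂ] E) (l : ℂ) : Prop :=
  FiniteDimensional ℂ (LinearMap.ker (scalarSub A l)) ∧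
    FiniteDimensional ℂ (E ⧸ LinearMap.range (scalarSub A l))

/-- The essential spectrum: the complement of the Fredholm domain. -/
def essentialSpectrum (A : E →ₗ.[ℂ] E) : Set ℂ := {l | ¬ IsFredholmAt A l}

/-- The essential spectral bound `s_ess(A) ∈ [-∞, ∞]`. -/
def essentialSpectralBound (A : E →ₗ.[ℂ] E) : EReal :=
  ⨆ l ∈ essentialSpectrum A, ((l.re : ℝ) : EReal)

end UnboundedOperator

/-! ### `C₀`-semigroups and local eventual positivity -/

/-- A `C₀`-semigroup on `E`; only the values at times `t ≥ 0` matter. -/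
structure C0Semigroup (E : Type*) [NormedAddCommGroup E] [NormedSpace ℂ E] where
  /-- the operator at time `t` -/
  op : ℝ → E →L[ℂ] E
  op_zero : op 0 = ContinuousLinearMap.id ℂ E
  op_add : ∀ s t : ℝ, 0 ≤ s → 0 ≤ t → op (s + t) = (op s).comp (op t)
  continuousOn_orbit : ∀ x : E, ContinuousOn (fun t => op t x) (Set.Ici 0)

namespace C0Semigroup

variable {E : Type*} [NormedAddCommGroup E] [NormedSpace ℂ E]

/-- `y = lim_{t ↓ 0} (T(t) x - x) / t`. -/
def HasDerivAtZero (T : C0Semigroup E) (x y : E) : Prop :=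
  Tendsto (fun t : ℝ => ((t : ℂ)⁻¹) • (T.op t x - x)) (𝓝[>] 0) (𝓝 y)

theorem HasDerivAtZero.unique {T : C0Semigroup E} {x y y' : E} (h : T.HasDerivAtZero x y)
    (h' : T.HasDerivAtZero x y') : y = y' := tendsto_nhds_unique h h'

theorem HasDerivAtZero.add {T : C0Semigroup E} {x y x' y' : E} (h : T.HasDerivAtZero x y)
    (h' : T.HasDerivAtZero x' y') : T.HasDerivAtZero (x + x') (y + y') := by
  refine (Tendsto.add h h').congr fun t => ?_
  rw [← smul_add, map_add]
  congr 1
  abel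

theorem HasDerivAtZero.smul {T : C0Semigroup E} {x y : E} (c : ℂ) (h : T.HasDerivAtZero x y) :
    T.HasDerivAtZero (c • x) (c • y) := by
  refine (Tendsto.const_smul h c).congr fun t => ?_
  rw [map_smul, ← smul_sub, smul_comm]

/-- The generator `A` of the semigroup: `A x = lim_{t ↓ 0} (T(t) x - x) / t`, with domain the set
of all `x` for which this limit exists. -/
def generator (T : C0Semigroup E) : E →ₗ.[ℂ] E where
  domain :=
    { carrier := {x | ∃ y, T.HasDerivAtZero x y}
      zero_mem' := ⟨0, by simp [HasDerivAtZero]⟩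
      add_mem' := by
        rintro x x' ⟨y, hy⟩ ⟨y', hy'⟩
        exact ⟨y + y', hy.add hy'⟩
      smul_mem' := by
        rintro c x ⟨y, hy⟩
        exact ⟨c • y, hy.smul c⟩ }
  toFun :=
    { toFun := fun x => x.2.choose
      map_add' := fun x x' =>
        (x + x').2.choose_spec.unique (x.2.choose_spec.add x'.2.choose_spec)
      map_smul' := fun c x => (c • x).2.choose_spec.unique (x.2.choose_spec.smul c) }

end C0Semigroup

/-- Local eventual positivity of `T` with respect to `(Pₙ)`: for all `n` and `0 ≠ f ∈ E₊` there is
`τ > 0` such that `Pₙ T(t) f ≥ 0` for all `t ≥ τ`. -/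
def HasLEP {F : Type*} [NormedAddCommGroup F] [Lattice F] [HasSolidNorm F] [IsOrderedAddMonoid F]
    [NormedSpace ℝ F] [IsOrderedModule ℝ F] [CompleteSpace F]
    (T : C0Semigroup (Complexification F))
    (P : ℕ → Complexification F →ₗ[ℂ] Complexification F) : Prop :=
  ∀ n : ℕ, ∀ f ∈ Complexification.positiveCone F, f ≠ 0 →
    ∃ τ : ℝ, 0 < τ ∧ ∀ t : ℝ, τ ≤ t → P n (T.op t f) ∈ Complexification.positiveCone F

end

/-!
By the analytic Fredholm theorem the resolvent is meromorphic on `{Re z > s_ess(A)}`, so points of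
the spectrum there are poles. For a test functional `Ψ = φ ∘ Pₙ` and `f ≥ 0`, the scalar orbit
`t ↦ Ψ (T(t) f)` is eventually nonnegative, and up to an entire function `z ↦ Ψ (R(z, A) f)` is the
Laplace transform of the positive measure `μ` with density `Ψ (T(t) f)`. By Landau's lemma on
Laplace transforms of positive measures, this transform converges for `Re z > a` as soon as
`z ↦ Ψ (R(z, A) f)` continues analytically along the real half-line `(a, ∞)`. There it satisfies
`|∫ e^{-zt} dμ| ≤ ∫ e^{-Re z t} dμ`: the behaviour of the resolvent at any point is dominated by its
behaviour at the real part of that point. Hence no spectral value lies to the right of all real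
ones, which makes `s(A)` a pole, and no pole on the line `Re z = s(A)` has larger order. The
leading Laurent coefficient at `s(A)` is a limit of `(x - s(A))ᵐ R(x, A)` along real `x ↓ s(A)`; it
maps positive vectors to positive vectors, and its values are eigenvectors.
-/

section PuncturedNeighborhoods

theorem eventually_nhdsNE_of_isPreconnected {X : Type*} [TopologicalSpace X] [T1Space X]
    [∀ x : X, (𝓝[≠] x).NeBot] {U : Set X} (hU : IsPreconnected U) {p : X → Prop}
    (hp : ∀ x ∈ U, (∃ᶠ y in 𝓝[≠] x, p y) → ∀ᶠ y in 𝓝[≠] x, p y)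
    (hex : ∃ x ∈ U, ∃ᶠ y in 𝓝[≠] x, p y) : ∀ x ∈ U, ∀ᶠ y in 𝓝[≠] x, p y := by
  obtain ⟨x₀, hx₀, hfreq⟩ := hex
  refine hU.subset_left_of_subset_union
    (isOpen_setOfPred_eventually_nhdsWithin (p := p))
    (isOpen_setOfPred_eventually_nhdsWithin (p := fun y => ¬ p y))
    (Set.disjoint_left.2 fun x hx hx' => ?_) (fun x hx => ?_) ⟨x₀, hx₀, hp x₀ hx₀ hfreq⟩
  · obtain ⟨y, hy, hy'⟩ := (Eventually.and hx hx').exists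
    exact hy' hy
  · by_cases h : ∃ᶠ y in 𝓝[≠] x, p y
    · exact Or.inl (hp x hx h)
    · exact Or.inr (not_frequently.1 h)

theorem eventuallyEq_nhdsNE_of_isPreconnected {𝕜 V : Type*} [NontriviallyNormedField 𝕜]
    [NormedAddCommGroup V] [NormedSpace 𝕜 V] {U : Set 𝕜} (hU : IsPreconnected U) {f g : 𝕜 → V}
    (hf : MeromorphicOn f U) (hg : MeromorphicOn g U)
    (hex : ∃ z ∈ U, ∃ᶠ w in 𝓝[≠] z, f w = g w) : ∀ z ∈ U, f =ᶠ[𝓝[≠] z] g :=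
  eventually_nhdsNE_of_isPreconnected hU
    (fun z hz => ((hf z hz).frequently_eq_iff_eventuallyEq (hg z hz)).1) hex

end PuncturedNeighborhoods

section AnalyticFredholm

section BanachAlgebra

variable {𝕜 R : Type*} [NontriviallyNormedField 𝕜] [NormedRing R] [NormedAlgebra 𝕜 R]
  [CompleteSpace R] {f : 𝕜 → R} {l : 𝕜}

theorem analyticAt_ringInverse_comp (hf : AnalyticAt 𝕜 f l) (hu : IsUnit (f l)) :
    AnalyticAt 𝕜 (fun z => Ring.inverse (f z)) l := by
  obtain ⟨u, hu⟩ := hu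
  exact AnalyticAt.fun_comp (g := Ring.inverse) (hu ▸ analyticAt_inverse u) hf

theorem eventually_isUnit_of_continuousAt {X : Type*} [TopologicalSpace X] {f : X → R} {x : X}
    (hf : ContinuousAt f x) (hu : IsUnit (f x)) : ∀ᶠ y in 𝓝 x, IsUnit (f y) :=
  hf.eventually (Units.isOpen.mem_nhds hu)

end BanachAlgebra

section FiniteDimensional

variable {𝕜 : Type*} [NontriviallyNormedField 𝕜] {l : 𝕜}

theorem analyticAt_matrix_det {n : Type*} [Fintype n] [DecidableEq n] {M : 𝕜 → Matrix n n 𝕜}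
    (h : ∀ i j, AnalyticAt 𝕜 (fun z => M z i j) l) : AnalyticAt 𝕜 (fun z => (M z).det) l := by
  simp only [Matrix.det_apply, Units.smul_def, zsmul_eq_mul]
  exact Finset.analyticAt_fun_sum _ fun σ _ =>
    analyticAt_const.mul (Finset.analyticAt_fun_prod _ fun i _ => h _ _)

theorem analyticAt_matrix_adjugate {n : Type*} [Fintype n] [DecidableEq n]
    {M : 𝕜 → Matrix n n 𝕜} (h : ∀ i j, AnalyticAt 𝕜 (fun z => M z i j) l) (i j : n) :
    AnalyticAt 𝕜 (fun z => (M z).adjugate i j) l := by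
  simp only [Matrix.adjugate_apply]
  refine analyticAt_matrix_det fun i' j' => ?_
  simp only [Matrix.updateRow_apply]
  split_ifs
  · exact analyticAt_const
  · exact h i' j'

theorem ringInverse_algEquiv {R S : Type*} [Ring R] [Ring S] [Algebra 𝕜 R] [Algebra 𝕜 S]
    (e : R ≃ₐ[𝕜] S) (a : R) : e (Ring.inverse a) = Ring.inverse (e a) := by
  by_cases ha : IsUnit a
  · obtain ⟨u, rfl⟩ := ha
    rw [Ring.inverse_unit]
    exact (Ring.inverse_unit (Units.map (e : R →* S) u)).symm
  · rw [Ring.inverse_non_unit a ha, map_zero, Ring.inverse_non_unit]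
    rwa [MulEquiv.isUnit_map]

variable [CompleteSpace 𝕜] {C : Type*} [NormedAddCommGroup C] [NormedSpace 𝕜 C]
  [FiniteDimensional 𝕜 C] {W : 𝕜 → C →L[𝕜] C}

theorem eventually_isUnit_and_meromorphicAt_ringInverse_of_finiteDimensional
    (hW : AnalyticAt 𝕜 W l) (hfreq : ∃ᶠ z in 𝓝[≠] l, IsUnit (W z)) :
    (∀ᶠ z in 𝓝[≠] l, IsUnit (W z)) ∧ MeromorphicAt (fun z => Ring.inverse (W z)) l := by
  let e : (C →L[𝕜] C) ≃ₐ[𝕜] Matrix _ _ 𝕜 := (Module.End.toContinuousLinearMap C).symm.trans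
    (LinearMap.toMatrixAlgEquiv (Module.finBasis 𝕜 C))
  have hentry : ∀ i j, AnalyticAt 𝕜 (fun z => e (W z) i j) l := fun i j =>
    (((LinearMap.toContinuousLinearMap (Matrix.entryLinearMap 𝕜 𝕜 i j ∘ₗ
      e.toLinearMap)).analyticAt _).comp hW)
  have hdet : AnalyticAt 𝕜 (fun z => (e (W z)).det) l := analyticAt_matrix_det hentry
  have hunit : ∀ z, IsUnit (W z) ↔ (e (W z)).det ≠ 0 := fun z => by
    rw [← isUnit_iff_ne_zero, ← Matrix.isUnit_iff_isUnit_det, MulEquiv.isUnit_map]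
  have hcramer : ∀ z, Ring.inverse (W z) =
      ∑ i, ∑ j, ((e (W z)).det⁻¹ * (e (W z)).adjugate i j) • e.symm (Matrix.single i j 1) := by
    intro z
    have hinv : e (Ring.inverse (W z)) = (e (W z)).det⁻¹ • (e (W z)).adjugate := by
      rw [ringInverse_algEquiv, ← Matrix.nonsing_inv_eq_ringInverse, Matrix.inv_def,
        Ring.inverse_eq_inv']
    rw [← e.symm_apply_apply (Ring.inverse (W z)), hinv, Matrix.matrix_eq_sum_single (_ • _)]
    simp only [map_sum, ← map_smul, Matrix.smul_single, smul_eq_mul, mul_one, Matrix.smul_apply]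
  refine ⟨?_, ?_⟩
  · simp only [hunit] at hfreq ⊢
    exact hdet.eventually_eq_zero_or_eventually_ne_zero.resolve_left fun h0 =>
      hfreq ((h0.filter_mono nhdsWithin_le_nhds).mono fun z hz => not_not.2 hz)
  · simp only [hcramer]
    exact MeromorphicAt.fun_sum fun i _ => MeromorphicAt.fun_sum fun j _ =>
      (hdet.meromorphicAt.inv.mul (analyticAt_matrix_adjugate hentry i j).meromorphicAt).smul
        (MeromorphicAt.const _ l)

end FiniteDimensional

section Composition

variable {𝕜 V₁ V₂ V₃ : Type*} [NontriviallyNormedField 𝕜] [NormedAddCommGroup V₁]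
  [NormedSpace 𝕜 V₁] [NormedAddCommGroup V₂] [NormedSpace 𝕜 V₂] [NormedAddCommGroup V₃]
  [NormedSpace 𝕜 V₃] {f : 𝕜 → V₂ →L[𝕜] V₃} {g : 𝕜 → V₁ →L[𝕜] V₂} {l : 𝕜}

theorem analyticAt_clm_comp (hf : AnalyticAt 𝕜 f l) (hg : AnalyticAt 𝕜 g l) :
    AnalyticAt 𝕜 (fun z => f z ∘L g z) l :=
  ((ContinuousLinearMap.compL 𝕜 V₁ V₂ V₃).analyticAt_bilinear (f l, g l)).comp₂ hf hg

theorem meromorphicAt_clm_comp (hf : MeromorphicAt f l) (hg : MeromorphicAt g l) :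
    MeromorphicAt (fun z => f z ∘L g z) l := by
  obtain ⟨m, hm⟩ := hf
  obtain ⟨n, hn⟩ := hg
  refine ⟨m + n, (analyticAt_clm_comp hm hn).congr (.of_forall fun z => ?_)⟩
  simp only [ContinuousLinearMap.smul_comp, ContinuousLinearMap.comp_smul, smul_smul, pow_add,
    mul_comm]

end Composition

section FiniteRangePerturbation

variable {𝕜 X C : Type*} [NontriviallyNormedField 𝕜] [NormedAddCommGroup X] [NormedSpace 𝕜 X]
  [NormedAddCommGroup C] [NormedSpace 𝕜 C] {a : X →L[𝕜] C} {b : C →L[𝕜] X}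

theorem one_add_comp_mul_one_sub_comp {W' : C →L[𝕜] C} (h : (1 + a ∘L b) * W' = 1) :
    (1 + b ∘L a) * (1 - b ∘L W' ∘L a) = 1 := by
  ext x
  have hW' : W' (a x) + a (b (W' (a x))) = a x := DFunLike.congr_fun h (a x)
  have hb : b (W' (a x)) + b (a (b (W' (a x)))) = b (a x) := by rw [← map_add, hW']
  simp [← hb]

theorem one_sub_comp_mul_one_add_comp {W' : C →L[𝕜] C} (h : W' * (1 + a ∘L b) = 1) :
    (1 - b ∘L W' ∘L a) * (1 + b ∘L a) = 1 := by
  ext x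
  have hW' : W' (a x) + W' (a (b (a x))) = a x := by simpa using DFunLike.congr_fun h (a x)
  simp [hW']

theorem isUnit_one_add_comp_swap (h : IsUnit (1 + a ∘L b)) : IsUnit (1 + b ∘L a) :=
  ⟨⟨_, _, one_add_comp_mul_one_sub_comp (Ring.mul_inverse_cancel _ h),
    one_sub_comp_mul_one_add_comp (Ring.inverse_mul_cancel _ h)⟩, rfl⟩

theorem ringInverse_one_add_comp (h : IsUnit (1 + a ∘L b)) :
    Ring.inverse (1 + b ∘L a) = 1 - b ∘L Ring.inverse (1 + a ∘L b) ∘L a :=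
  Ring.inverse_unit ⟨_, _, one_add_comp_mul_one_sub_comp (Ring.mul_inverse_cancel _ h),
    one_sub_comp_mul_one_add_comp (Ring.inverse_mul_cancel _ h)⟩

end FiniteRangePerturbation

section Local

open LinearMap.FiniteRangeSetoid

variable {𝕜 X : Type*} [NontriviallyNormedField 𝕜] [CompleteSpace 𝕜] [NormedAddCommGroup X]
  [NormedSpace 𝕜 X] [CompleteSpace X]

open ContinuousLinearMap in
theorem exists_isUnit_equiv_of_isFredholm {B : X →L[𝕜] X} (hB : B.IsFredholm)
    (hlim : B ∈ closure {U | IsUnit U}) :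
    ∃ D : X →L[𝕜] X, IsUnit D ∧ (B : X →ₗ[𝕜] X) ≈ (D : X →ₗ[𝕜] X) := by
  obtain ⟨S, hS⟩ := hB.exists_isQuasiInverse
  have hcont : ContinuousAt (fun U : X →L[𝕜] X => 1 + S * (U - B)) B := by fun_prop
  obtain ⟨U, ⟨J, hJ⟩, ⟨V, rfl⟩⟩ := mem_closure_iff_nhds.1 hlim _
    (eventually_isUnit_of_continuousAt hcont (by simp))
  have hSV : ((S * V : X →L[𝕜] X) : X →ₗ[𝕜] X) ≈ (J : X →L[𝕜] X) := by
    have hdiff : S * V = J + (S * B - 1) := by rw [hJ]; noncomm_ring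
    rw [LinearMap.FiniteRangeSetoid.equiv_iff_hasFiniteRange, hdiff, toLinearMap_add,
      add_sub_cancel_left, toLinearMap_sub, ← LinearMap.FiniteRangeSetoid.equiv_iff_hasFiniteRange]
    exact hS.1
  have hSJ : (S : X →ₗ[𝕜] X) ≈ ((J * V⁻¹ : (X →L[𝕜] X)ˣ) : X →L[𝕜] X) := by
    rw [← Units.mul_inv_cancel_right S V]
    exact LinearMap.FiniteRangeSetoid.equiv_comp_right hSV
  refine ⟨((J * V⁻¹)⁻¹ : (X →L[𝕜] X)ˣ), Units.isUnit _, hS.equiv_of_left ?_ hSJ⟩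
  exact LinearEquiv.isQuasiInverse
    (ContinuousLinearEquiv.unitsEquiv 𝕜 X (J * V⁻¹)⁻¹).toLinearEquiv

variable {B : 𝕜 → X →L[𝕜] X} {l : 𝕜}

/- With `F = B l - D` of finite range and `D z = B z - F` invertible near `l`, one has
`B z = D z (1 + (D z)⁻¹ F)`, and swapping the two factors of `(D z)⁻¹ F` through the range of `F`
reduces the inversion of `B z` to that of an operator on the range of `F`. -/
theorem eventually_isUnit_and_meromorphicAt_ringInverse_of_isFredholm (hB : AnalyticAt 𝕜 B l)
    (hfred : (B l).IsFredholm) (hfreq : ∃ᶠ z in 𝓝[≠] l, IsUnit (B z)) :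
    (∀ᶠ z in 𝓝[≠] l, IsUnit (B z)) ∧ MeromorphicAt (fun z => Ring.inverse (B z)) l := by
  obtain ⟨D, hD, hBD⟩ := exists_isUnit_equiv_of_isFredholm hfred
    (mem_closure_of_frequently_of_tendsto hfreq
      (hB.continuousAt.tendsto.mono_left nhdsWithin_le_nhds))
  set F : X →L[𝕜] X := B l - D with hF
  have : FiniteDimensional 𝕜 F.range :=
    Module.Finite.iff_fg.2 (LinearMap.FiniteRangeSetoid.equiv_iff_hasFiniteRange.1 hBD)
  let q : X →L[𝕜] F.range := F.rangeRestrict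
  let b : 𝕜 → F.range →L[𝕜] X := fun z => Ring.inverse (B z - F) ∘L F.range.subtypeL
  have hDan : AnalyticAt 𝕜 (fun z => B z - F) l := hB.sub analyticAt_const
  have hDl : IsUnit (B l - F) := by simpa [hF] using hD
  have hDinv := analyticAt_ringInverse_comp hDan hDl
  have hban : AnalyticAt 𝕜 b l := analyticAt_clm_comp hDinv analyticAt_const
  have hunit : ∀ᶠ z in 𝓝[≠] l, IsUnit (B z - F) :=
    (eventually_isUnit_of_continuousAt hDan.continuousAt hDl).filter_mono nhdsWithin_le_nhds
  have hfactor : ∀ z, IsUnit (B z - F) → B z = (B z - F) * (1 + b z ∘L q) := fun z hz => by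
    have hbq : b z ∘L q = Ring.inverse (B z - F) * F := rfl
    rw [hbq, mul_add, ← mul_assoc, Ring.mul_inverse_cancel _ hz]
    noncomm_ring
  have hiff : ∀ z, IsUnit (B z - F) → (IsUnit (B z) ↔ IsUnit (1 + q ∘L b z)) := fun z hz => by
    rw [hfactor z hz, hz.mul_left_iff]
    exact ⟨isUnit_one_add_comp_swap, isUnit_one_add_comp_swap⟩
  obtain ⟨hWunit, hWmero⟩ := eventually_isUnit_and_meromorphicAt_ringInverse_of_finiteDimensional
    (W := fun z => 1 + q ∘L b z) (analyticAt_const.add (analyticAt_clm_comp analyticAt_const hban))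
    ((hfreq.and_eventually hunit).mono fun z hz => (hiff z hz.2).1 hz.1)
  refine ⟨(hWunit.and hunit).mono fun z hz => (hiff z hz.2).2 hz.1, ?_⟩
  have hmero : MeromorphicAt (fun z => (1 - b z ∘L Ring.inverse (1 + q ∘L b z) ∘L q) *
      Ring.inverse (B z - F)) l :=
    meromorphicAt_clm_comp ((MeromorphicAt.const 1 l).sub (meromorphicAt_clm_comp
      hban.meromorphicAt (meromorphicAt_clm_comp hWmero (.const q l)))) hDinv.meromorphicAt
  refine hmero.congr ((hWunit.and hunit).mono fun z hz => ?_)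
  beta_reduce
  rw [← ringInverse_one_add_comp hz.1, ← Ring.inverse_mul (.inl hz.2), ← hfactor z hz.2]

theorem eventually_isUnit_and_meromorphicAt_ringInverse {U : Set 𝕜} (hU : IsPreconnected U)
    (hB : ∀ z ∈ U, AnalyticAt 𝕜 B z) (hfred : ∀ z ∈ U, (B z).IsFredholm)
    (hex : ∃ z ∈ U, IsUnit (B z)) {z : 𝕜} (hz : z ∈ U) :
    (∀ᶠ w in 𝓝[≠] z, IsUnit (B w)) ∧ MeromorphicAt (fun w => Ring.inverse (B w)) z := by
  have hlocal : ∀ z ∈ U, (∃ᶠ w in 𝓝[≠] z, IsUnit (B w)) → _ := fun z hz =>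
    eventually_isUnit_and_meromorphicAt_ringInverse_of_isFredholm (hB z hz) (hfred z hz)
  obtain ⟨z₀, hz₀, hunit⟩ := hex
  have hfreq : ∃ᶠ w in 𝓝[≠] z₀, IsUnit (B w) :=
    ((eventually_isUnit_of_continuousAt (hB z₀ hz₀).continuousAt hunit).filter_mono
      nhdsWithin_le_nhds).frequently
  exact hlocal z hz (eventually_nhdsNE_of_isPreconnected hU (fun w hw h => (hlocal w hw h).1)
    ⟨z₀, hz₀, hfreq⟩ z hz).frequently

end Local

section Banach

variable {𝕜 X Y : Type*} [RCLike 𝕜] [NormedAddCommGroup X] [NormedSpace 𝕜 X] [CompleteSpace X]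
  [NormedAddCommGroup Y] [NormedSpace 𝕜 Y] [CompleteSpace Y]

theorem isFredholm_of_finiteDimensional_ker_coker (B : X →L[𝕜] Y)
    [FiniteDimensional 𝕜 B.ker] [FiniteDimensional 𝕜 (Y ⧸ B.range)] : B.IsFredholm := by
  obtain ⟨X₁, hX₁, hcompl⟩ :=
    (Submodule.ClosedComplemented.of_finiteDimensional B.ker).exists_isClosed_isCompl
  obtain ⟨C, hC⟩ := B.range.exists_isCompl
  have : CompleteSpace X₁ := hX₁.completeSpace_coe
  have : FiniteDimensional 𝕜 C := (Submodule.quotientEquivOfIsCompl _ _ hC).finiteDimensional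
  have : FiniteDimensional 𝕜 (X ⧸ X₁) :=
    (Submodule.quotientEquivOfIsCompl _ _ hcompl.symm).symm.finiteDimensional
  let f : X₁ →L[𝕜] Y := B ∘L X₁.subtypeL
  have hinj : Function.Injective f := (injective_iff_map_eq_zero f).2 fun x hx =>
    Subtype.ext (hcompl.disjoint.le_bot ⟨hx, x.2⟩)
  have hsurj : ∀ x, ∃ x₁, f x₁ = B x := fun x => by
    obtain ⟨x₀, hx₀, x₁, hx₁, rfl⟩ := Submodule.mem_sup.1
      (hcompl.sup_eq_top ▸ Submodule.mem_top : x ∈ B.ker ⊔ X₁)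
    have hBx₀ : B x₀ = 0 := hx₀
    exact ⟨⟨x₁, hx₁⟩, by simp [f, hBx₀]⟩
  have hrange : f.range = B.range := le_antisymm (LinearMap.range_comp_le_range _ _) <| by
    rintro _ ⟨x, rfl⟩
    exact hsurj x
  have hclosed : IsClosed (B.range : Set Y) := hrange ▸
    f.closed_complemented_range_of_isCompl_of_ker_eq_bot C (hrange ▸ hC)
      C.closed_of_finiteDimensional (LinearMap.ker_eq_bot.2 hinj)
  have : CompleteSpace B.range := hclosed.completeSpace_coe
  have hmaps : Set.MapsTo B X₁ B.range := fun x _ => ⟨x, rfl⟩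
  refine .of_isInvertible_restrict hX₁ hclosed hmaps
    ⟨.ofBijective (B.restrict hmaps) ?_ ?_, rfl⟩
  · exact LinearMap.ker_eq_bot.2 fun x y hxy => hinj (congrArg Subtype.val hxy)
  · rw [LinearMap.range_eq_top]
    rintro ⟨_, x, rfl⟩
    obtain ⟨x₁, hx₁⟩ := hsurj x
    exact ⟨x₁, Subtype.ext hx₁⟩

end Banach

end AnalyticFredholm

theorem tendsto_add_ofReal_nhdsNE (l : ℂ) :
    Tendsto (fun ε : ℝ => l + ε) (𝓝[>] 0) (𝓝[≠] l) := by
  refine tendsto_nhdsWithin_iff.2 ⟨?_, ?_⟩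
  · exact (Continuous.tendsto' (by fun_prop) 0 l (by simp)).mono_left nhdsWithin_le_nhds
  · filter_upwards [self_mem_nhdsWithin] with ε (hε : 0 < ε)
    simpa using hε.ne'

namespace UnboundedOperator

variable {E : Type*} [NormedAddCommGroup E] [NormedSpace ℂ E] {A : E →ₗ.[ℂ] E} {l μ : ℂ}
  {R R' : E →L[ℂ] E}

section Algebraic

theorem scalarSub_apply (A : E →ₗ.[ℂ] E) (l : ℂ) (x : A.domain) :
    scalarSub A l x = l • (x : E) - A x := rfl

theorem scalarSub_eq_add (A : E →ₗ.[ℂ] E) (l μ : ℂ) (x : A.domain) :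
    scalarSub A l x = scalarSub A μ x + (l - μ) • (x : E) := by
  simp only [scalarSub_apply, sub_smul]
  abel

theorem isResolventAt_resolvent (h : l ∈ resolventSet A) : IsResolventAt A l (resolvent A l) := by
  have h' : ∃ R, IsResolventAt A l R := h
  rw [resolvent, dif_pos h']
  exact h'.choose_spec

theorem resolvent_of_notMem (h : l ∉ resolventSet A) : resolvent A l = 0 := dif_neg h

theorem IsResolventAt.mem (h : IsResolventAt A l R) : l ∈ resolventSet A := ⟨R, h⟩

theorem IsResolventAt.unique (h : IsResolventAt A l R) (h' : IsResolventAt A l R') : R = R' := by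
  ext y
  obtain ⟨x, hx, hy⟩ := h.2 y
  rw [← hx, ← hy, h'.1 x]

theorem IsResolventAt.resolvent_eq (h : IsResolventAt A l R) : resolvent A l = R :=
  (isResolventAt_resolvent h.mem).unique h

theorem IsResolventAt.one_add_smul_scalarSub (h : IsResolventAt A μ R) (l : ℂ) (x : A.domain) :
    (1 + (l - μ) • R) (scalarSub A μ x) = scalarSub A l x := by
  rw [scalarSub_eq_add A l μ]
  simp [h.1 x]

theorem IsResolventAt.eq_sub_mul_right (h : IsResolventAt A μ R) (h' : IsResolventAt A l R') :
    R' = R - (l - μ) • (R' * R) := by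
  ext y
  obtain ⟨x, hx, rfl⟩ := h.2 y
  have h'x : R' ((1 + (l - μ) • R) (scalarSub A μ x)) = x := by
    rw [h.one_add_smul_scalarSub, h'.1]
  rw [eq_comm, _root_.sub_apply, ← hx, sub_eq_iff_eq_add]
  simpa using h'x.symm

theorem IsResolventAt.eq_sub_mul_left (h : IsResolventAt A μ R) (h' : IsResolventAt A l R') :
    R' = R - (l - μ) • (R * R') := by
  have hsymm := h'.eq_sub_mul_right h
  rw [← neg_sub l μ, neg_smul, sub_neg_eq_add] at hsymm
  exact eq_sub_of_add_eq hsymm.symm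

theorem isUnit_one_add_smul {𝕜 S : Type*} [CommRing 𝕜] [Ring S] [Algebra 𝕜 S] {r r' : S} {c : 𝕜}
    (hl : r' = r - c • (r * r')) (hr : r' = r - c • (r' * r)) : IsUnit (1 + c • r) := by
  have hl' : r - r' - c • (r * r') = 0 := by rw [sub_right_comm, ← hl, sub_self]
  have hr' : r - r' - c • (r' * r) = 0 := by rw [sub_right_comm, ← hr, sub_self]
  refine ⟨⟨_, 1 - c • r', ?_, ?_⟩, rfl⟩
  · calc (1 + c • r) * (1 - c • r') = 1 + c • (r - r' - c • (r * r')) := by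
          simp only [add_mul, mul_sub, one_mul, mul_one, smul_mul_smul_comm, smul_sub, smul_smul]
          abel
      _ = 1 := by rw [hl', smul_zero, add_zero]
  · calc (1 - c • r') * (1 + c • r) = 1 + c • (r - r' - c • (r' * r)) := by
          simp only [sub_mul, mul_add, one_mul, mul_one, smul_mul_smul_comm, smul_sub, smul_smul]
          abel
      _ = 1 := by rw [hr', smul_zero, add_zero]

theorem IsResolventAt.of_isUnit (h : IsResolventAt A μ R) (hu : IsUnit (1 + (l - μ) • R)) :
    IsResolventAt A l (R * Ring.inverse (1 + (l - μ) • R)) := by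
  refine ⟨fun x => ?_, fun y => ?_⟩
  · rw [← h.one_add_smul_scalarSub, ← mul_apply_eq_comp, mul_assoc,
      Ring.inverse_mul_cancel _ hu, mul_one]
    exact h.1 x
  · obtain ⟨x, hx, hy⟩ := h.2 (Ring.inverse (1 + (l - μ) • R) y)
    refine ⟨x, hx, ?_⟩
    rw [← h.one_add_smul_scalarSub, hy, ← mul_apply_eq_comp, Ring.mul_inverse_cancel _ hu]
    rfl

theorem IsResolventAt.mem_resolventSet_iff (h : IsResolventAt A μ R) :
    l ∈ resolventSet A ↔ IsUnit (1 + (l - μ) • R) :=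
  ⟨fun ⟨_, h'⟩ => isUnit_one_add_smul (h.eq_sub_mul_left h') (h.eq_sub_mul_right h'),
    fun hu => (h.of_isUnit hu).mem⟩

theorem IsResolventAt.resolvent_eq_mul_ringInverse (h : IsResolventAt A μ R) :
    resolvent A = fun z => R * Ring.inverse (1 + (z - μ) • R) := by
  funext z
  by_cases hu : IsUnit (1 + (z - μ) • R)
  · exact (h.of_isUnit hu).resolvent_eq
  · rw [resolvent_of_notMem (hu ∘ h.mem_resolventSet_iff.1), Ring.inverse_non_unit _ hu, mul_zero]

theorem resolvent_commute (hl : l ∈ resolventSet A) {S : E →L[ℂ] E}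
    (hS : ∀ x : A.domain, ∃ h : S x ∈ A.domain, A ⟨S x, h⟩ = S (A x)) :
    Commute (resolvent A l) S := by
  have hR := isResolventAt_resolvent hl
  ext y
  obtain ⟨x, hx, rfl⟩ := hR.2 y
  obtain ⟨h, hA⟩ := hS x
  have hSx : S (scalarSub A l x) = scalarSub A l ⟨S x, h⟩ := by
    rw [scalarSub_apply, scalarSub_apply, hA, map_sub, map_smul]
  calc resolvent A l (S (scalarSub A l x)) = S x := by rw [hSx, hR.1]
    _ = S (resolvent A l (scalarSub A l x)) := by rw [hx]

end Algebraic

section Analytic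

variable [CompleteSpace E]

theorem analyticAt_one_add_smul {𝕜 V : Type*} [NontriviallyNormedField 𝕜] [NormedRing V]
    [NormedAlgebra 𝕜 V] (r : V) (c z : 𝕜) : AnalyticAt 𝕜 (fun w : 𝕜 => 1 + (w - c) • r) z := by
  fun_prop

theorem isOpen_resolventSet (A : E →ₗ.[ℂ] E) : IsOpen (resolventSet A) := by
  refine isOpen_iff_mem_nhds.2 fun l ⟨R, h⟩ => ?_
  filter_upwards [eventually_isUnit_of_continuousAt (analyticAt_one_add_smul R l l).continuousAt
    (by simp)] with z hz
  exact h.mem_resolventSet_iff.2 hz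

theorem analyticAt_resolvent (hl : l ∈ resolventSet A) : AnalyticAt ℂ (resolvent A) l := by
  obtain ⟨R, h⟩ := hl
  rw [h.resolvent_eq_mul_ringInverse]
  exact analyticAt_const.mul (analyticAt_ringInverse_comp (analyticAt_one_add_smul R l l) (by simp))

theorem analyticAt_apply_resolvent (Ψ : E →L[ℂ] ℂ) (f : E) (hl : l ∈ resolventSet A) :
    AnalyticAt ℂ (fun z => Ψ (resolvent A z f)) l :=
  ((Ψ ∘L ContinuousLinearMap.apply ℂ E f).analyticAt _).comp (analyticAt_resolvent hl)

theorem IsResolventAt.isFredholm_one_add_smul (h : IsResolventAt A μ R) (hl : IsFredholmAt A l) :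
    (1 + (l - μ) • R).IsFredholm := by
  obtain ⟨hker, hcoker⟩ := hl
  have hsurj : Function.Surjective (scalarSub A μ) := fun y => (h.2 y).imp fun _ hx => hx.2
  have hcomp : ((1 + (l - μ) • R : E →L[ℂ] E) : E →ₗ[ℂ] E) ∘ₗ scalarSub A μ = scalarSub A l :=
    LinearMap.ext (h.one_add_smul_scalarSub l)
  have hrange : (1 + (l - μ) • R).range = (scalarSub A l).range := by
    rw [← hcomp, LinearMap.range_comp_of_range_eq_top _ (LinearMap.range_eq_top.2 hsurj)]
  have hker' : (1 + (l - μ) • R).ker = (scalarSub A l).ker.map (scalarSub A μ) := by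
    rw [← hcomp, LinearMap.ker_comp, Submodule.map_comap_eq_of_surjective hsurj]
  have : FiniteDimensional ℂ (1 + (l - μ) • R).ker := hker' ▸ inferInstance
  have : FiniteDimensional ℂ (E ⧸ (1 + (l - μ) • R).range) := hrange ▸ hcoker
  exact isFredholm_of_finiteDimensional_ker_coker _

theorem eventually_mem_resolventSet_and_meromorphicAt_resolvent {U : Set ℂ} (hU : IsPreconnected U)
    (hF : ∀ z ∈ U, IsFredholmAt A z) (hex : ∃ z ∈ U, z ∈ resolventSet A) (hl : l ∈ U) :
    (∀ᶠ z in 𝓝[≠] l, z ∈ resolventSet A) ∧ MeromorphicAt (resolvent A) l := by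
  obtain ⟨μ, hμU, R, h⟩ := hex
  obtain ⟨hunit, hmero⟩ := eventually_isUnit_and_meromorphicAt_ringInverse hU
    (fun z _ => analyticAt_one_add_smul R μ z) (fun z hz => h.isFredholm_one_add_smul (hF z hz))
    ⟨μ, hμU, by simp⟩ hl
  refine ⟨hunit.mono fun z hz => h.mem_resolventSet_iff.2 hz, ?_⟩
  rw [h.resolvent_eq_mul_ringInverse]
  exact meromorphicAt_clm_comp (.const R l) hmero

end Analytic

section Poles

theorem meromorphicAt_apply_resolvent (Ψ : E →L[ℂ] ℂ) (f : E)
    (hl : MeromorphicAt (resolvent A) l) : MeromorphicAt (fun z => Ψ (resolvent A z f)) l := by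
  obtain ⟨n, hn⟩ := hl
  refine ⟨n, (((Ψ ∘L ContinuousLinearMap.apply ℂ E f).analyticAt _).comp hn).congr
    (.of_forall fun w => ?_)⟩
  simp

theorem mem_resolventSet_of_tendsto_resolvent (hl : ∀ᶠ z in 𝓝[≠] l, z ∈ resolventSet A)
    (hR : Tendsto (resolvent A) (𝓝[≠] l) (𝓝 R')) : l ∈ resolventSet A := by
  obtain ⟨μ, hμ⟩ := hl.exists
  have h := isResolventAt_resolvent hμ
  have hsub : Tendsto (fun z : ℂ => z - μ) (𝓝[≠] l) (𝓝 (l - μ)) :=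
    (Continuous.tendsto (by fun_prop) l).mono_left nhdsWithin_le_nhds
  refine h.mem_resolventSet_iff.2 (isUnit_one_add_smul
    (tendsto_nhds_unique_of_eventuallyEq hR (tendsto_const_nhds.sub (hsub.smul (hR.const_mul _)))
      (hl.mono fun z hz => h.eq_sub_mul_left (isResolventAt_resolvent hz)))
    (tendsto_nhds_unique_of_eventuallyEq hR (tendsto_const_nhds.sub (hsub.smul (hR.mul_const _)))
      (hl.mono fun z hz => h.eq_sub_mul_right (isResolventAt_resolvent hz))))

theorem exists_isResolventPole (hls : l ∈ spectrum A) (hl : ∀ᶠ z in 𝓝[≠] l, z ∈ resolventSet A)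
    (hm : MeromorphicAt (resolvent A) l) : ∃ k, IsResolventPole A l k := by
  have hneg : meromorphicOrderAt (resolvent A) l < 0 := by
    by_contra! hnonneg
    obtain ⟨R', hR'⟩ := tendsto_nhds_of_meromorphicOrderAt_nonneg hm hnonneg
    exact hls (mem_resolventSet_of_tendsto_resolvent hl hR')
  lift meromorphicOrderAt (resolvent A) l to ℤ using hneg.ne_top with n hn
  have hn0 : n < 0 := by exact_mod_cast hneg
  refine ⟨n.natAbs, by omega, hls, hl, ?_⟩
  rw [← hn, Int.ofNat_natAbs_of_nonpos hn0.le, neg_neg]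

/-- `Q` is the coefficient of `(z - l)⁻ᵏ` in the Laurent expansion at `l` of a resolvent having at
`l` a pole of order at most `k`. The order is not required to be exactly `k`, so `Q = 0` is
allowed. -/
def IsLeadingCoeff (A : E →ₗ.[ℂ] E) (l : ℂ) (k : ℕ) (Q : E →L[ℂ] E) : Prop :=
  Tendsto (fun z => (z - l) ^ k • resolvent A z) (𝓝[≠] l) (𝓝 Q)

variable {Q : E →L[ℂ] E} {k : ℕ}

theorem IsResolventPole.exists_isLeadingCoeff (h : IsResolventPole A l k) :
    ∃ Q, Q ≠ 0 ∧ IsLeadingCoeff A l k Q := by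
  obtain ⟨hk, -, -, hord⟩ := h
  have hm : MeromorphicAt (resolvent A) l := by
    refine meromorphicAt_of_meromorphicOrderAt_ne_zero ?_
    rw [hord]
    exact_mod_cast (by omega : -(k : ℤ) ≠ 0)
  obtain ⟨g, hg, hg0, hgeq⟩ := (meromorphicOrderAt_eq_int_iff hm).1 hord
  refine ⟨g l, hg0, (hg.continuousAt.tendsto.mono_left nhdsWithin_le_nhds).congr' ?_⟩
  filter_upwards [hgeq, self_mem_nhdsWithin] with z hz hzl
  rw [hz, smul_smul, zpow_neg, zpow_natCast,
    mul_inv_cancel₀ (pow_ne_zero k (sub_ne_zero.2 hzl)), one_smul]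

theorem IsLeadingCoeff.tendsto_apply (hQ : IsLeadingCoeff A l k Q) (f : E) :
    Tendsto (fun z => (z - l) ^ k • resolvent A z f) (𝓝[≠] l) (𝓝 (Q f)) :=
  ((ContinuousLinearMap.apply ℂ E f).continuous.tendsto Q).comp hQ

theorem IsLeadingCoeff.commute (hQ : IsLeadingCoeff A l k Q) {S : E →L[ℂ] E}
    (hS : ∀ᶠ z in 𝓝[≠] l, Commute (resolvent A z) S) : Commute Q S :=
  tendsto_nhds_unique_of_eventuallyEq (hQ.mul_const S) (hQ.const_mul S)
    (hS.mono fun _ hz => hz.smul_left _)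

theorem IsLeadingCoeff.eq_neg_smul (hQ : IsLeadingCoeff A l k Q) (hk : k ≠ 0)
    (hl : ∀ᶠ z in 𝓝[≠] l, z ∈ resolventSet A) (hR : IsResolventAt A μ R) :
    Q = -((l - μ) • (R * Q)) := by
  have hsub : ∀ w, Tendsto (fun z : ℂ => z - w) (𝓝[≠] l) (𝓝 (l - w)) := fun w =>
    (Continuous.tendsto (by fun_prop) l).mono_left nhdsWithin_le_nhds
  have hlim := (((hsub l).pow k).smul_const R).sub ((hsub μ).smul (hQ.const_mul R))
  rw [sub_self, zero_pow hk, zero_smul, zero_sub] at hlim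
  refine tendsto_nhds_unique_of_eventuallyEq hQ hlim (hl.mono fun z hz => ?_)
  beta_reduce
  conv_lhs => rw [hR.eq_sub_mul_left (isResolventAt_resolvent hz), smul_sub]
  rw [mul_smul_comm, smul_comm (z - μ)]

theorem IsLeadingCoeff.exists_eigenvector (hQ : IsLeadingCoeff A l k Q) (hk : k ≠ 0)
    (hl : ∀ᶠ z in 𝓝[≠] l, z ∈ resolventSet A) (f : E) :
    ∃ v : A.domain, (v : E) = Q f ∧ A v = l • (v : E) := by
  obtain ⟨μ, hμ⟩ := hl.exists
  have hR := isResolventAt_resolvent hμ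
  obtain ⟨v, hv, hv'⟩ := hR.2 (-((l - μ) • Q f))
  have hvQ : (v : E) = Q f := by
    rw [hv, map_neg, map_smul]
    exact (DFunLike.congr_fun (hQ.eq_neg_smul hk hl hR) f).symm
  refine ⟨v, hvQ, (sub_eq_zero.1 ?_).symm⟩
  rw [← scalarSub_apply, scalarSub_eq_add A l μ, hv', hvQ, neg_add_cancel]

theorem IsLeadingCoeff.tendsto_apply_add_ofReal (hQ : IsLeadingCoeff A l k Q) (Ψ : E →L[ℂ] ℂ)
    (f : E) : Tendsto (fun ε : ℝ => (ε : ℂ) ^ k * Ψ (resolvent A (l + ε) f)) (𝓝[>] 0)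
      (𝓝 (Ψ (Q f))) := by
  refine (((Ψ.continuous.tendsto _).comp (hQ.tendsto_apply f)).comp
    (tendsto_add_ofReal_nhdsNE l)).congr fun ε => ?_
  simp

end Poles

section SpectralBound

theorem mem_resolventSet_of_spectralBound_lt (h : spectralBound A < (l.re : EReal)) :
    l ∈ resolventSet A :=
  not_not.1 fun hl => (le_iSup₂ (f := fun l (_ : l ∈ spectrum A) => (l.re : EReal)) l hl).not_gt h

theorem isFredholmAt_of_essentialSpectralBound_lt (h : essentialSpectralBound A < (l.re : EReal)) :
    IsFredholmAt A l :=
  not_not.1 fun hl =>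
    (le_iSup₂ (f := fun l (_ : l ∈ essentialSpectrum A) => (l.re : EReal)) l hl).not_gt h

theorem eventually_mem_resolventSet_and_meromorphicAt_resolvent_of_lt_re [CompleteSpace E]
    (htop : spectralBound A < ⊤) {α : ℝ} (hα : essentialSpectralBound A < α) (hl : α < l.re) :
    (∀ᶠ z in 𝓝[≠] l, z ∈ resolventSet A) ∧ MeromorphicAt (resolvent A) l := by
  obtain ⟨ω, hω, -⟩ := EReal.exists_between_coe_real htop
  refine eventually_mem_resolventSet_and_meromorphicAt_resolvent (U := {z | α < z.re})
    (convex_halfSpace_re_gt α).isPreconnected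
    (fun z hz => isFredholmAt_of_essentialSpectralBound_lt
      (hα.trans (EReal.coe_lt_coe_iff.2 hz)))
    ⟨(max α ω + 1 : ℝ), (le_max_left α ω).trans_lt (lt_add_one _),
      mem_resolventSet_of_spectralBound_lt (hω.trans (EReal.coe_lt_coe_iff.2 ?_))⟩ hl
  exact (le_max_right α ω).trans_lt (lt_add_one _)

end SpectralBound

end UnboundedOperator

namespace C0Semigroup

open MeasureTheory UnboundedOperator

variable {E : Type*} [NormedAddCommGroup E] [NormedSpace ℂ E] {T : C0Semigroup E}

section Orbits

variable {s t : ℝ} {x y : E}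

theorem op_zero_apply (T : C0Semigroup E) (x : E) : T.op 0 x = x :=
  DFunLike.congr_fun T.op_zero x

theorem op_add_apply (T : C0Semigroup E) (hs : 0 ≤ s) (ht : 0 ≤ t) (x : E) :
    T.op (s + t) x = T.op s (T.op t x) :=
  DFunLike.congr_fun (T.op_add s t hs ht) x

theorem op_comm (T : C0Semigroup E) (hs : 0 ≤ s) (ht : 0 ≤ t) (x : E) :
    T.op s (T.op t x) = T.op t (T.op s x) := by
  rw [← T.op_add_apply hs ht, add_comm, T.op_add_apply ht hs]

theorem hasDerivAtZero_generator (v : T.generator.domain) :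
    T.HasDerivAtZero (v : E) (T.generator v) :=
  v.2.choose_spec

theorem HasDerivAtZero.exists_generator (h : T.HasDerivAtZero x y) :
    ∃ v : T.generator.domain, (v : E) = x ∧ T.generator v = y :=
  ⟨⟨x, y, h⟩, rfl, (hasDerivAtZero_generator ⟨x, y, h⟩).unique h⟩

theorem HasDerivAtZero.map {S : E →L[ℂ] E} (hS : ∀ t, 0 ≤ t → ∀ f, S (T.op t f) = T.op t (S f))
    (h : T.HasDerivAtZero x y) : T.HasDerivAtZero (S x) (S y) := by
  refine ((S.continuous.tendsto _).comp h).congr' ?_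
  filter_upwards [self_mem_nhdsWithin] with t (ht : 0 < t)
  rw [Function.comp_apply, map_smul, map_sub, hS t ht.le]

theorem resolvent_op_commute {z : ℂ} (hz : z ∈ resolventSet T.generator) (ht : 0 ≤ t) :
    Commute (resolvent T.generator z) (T.op t) :=
  resolvent_commute hz fun v => by
    obtain ⟨w, hw, hw'⟩ := ((hasDerivAtZero_generator v).map (S := T.op t)
      fun s hs f => T.op_comm ht hs f).exists_generator
    exact ⟨hw ▸ w.2, by rw [← hw']; congr 1; exact Subtype.ext hw.symm⟩

theorem HasDerivAtZero.hasDerivWithinAt_op (h : T.HasDerivAtZero x y) (ht : 0 ≤ t) :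
    HasDerivWithinAt (fun s => T.op s x) (T.op t y) (Set.Ici t) t := by
  rw [← hasDerivWithinAt_Ioi_iff_Ici, hasDerivWithinAt_iff_tendsto_slope' Set.self_notMem_Ioi]
  have hsub : Tendsto (fun s => s - t) (𝓝[>] t) (𝓝[>] 0) := by
    refine tendsto_nhdsWithin_iff.2 ⟨?_, ?_⟩
    · exact ((continuous_sub_right t).tendsto' t 0 (sub_self t)).mono_left nhdsWithin_le_nhds
    · filter_upwards [self_mem_nhdsWithin] with s (hs : t < s) using sub_pos.2 hs
  refine (((T.op t).continuous.tendsto y).comp (h.comp hsub)).congr' ?_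
  filter_upwards [self_mem_nhdsWithin] with s hs
  rw [Function.comp_apply, Function.comp_apply, map_smul, map_sub,
    ← T.op_add_apply ht (sub_pos.2 hs).le, add_sub_cancel, slope_def_module, ← Complex.ofReal_inv,
    Complex.coe_smul]

theorem hasDerivAt_exp_mul_ofReal (c : ℂ) (s : ℝ) :
    HasDerivAt (fun s : ℝ => Complex.exp (c * s)) (Complex.exp (c * s) * c) s := by
  simpa using ((Complex.ofRealCLM.hasDerivAt (x := s)).const_mul c).cexp

theorem op_apply_of_generator_apply_eq_smul {l : ℂ} {v : T.generator.domain}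
    (hv : T.generator v = l • (v : E)) (ht : 0 ≤ t) :
    T.op t v = Complex.exp (l * t) • (v : E) := by
  have hconst := constant_of_has_deriv_right_zero (a := 0) (b := t)
    (f := fun s : ℝ => Complex.exp (-l * s) • T.op s v)
    ((Continuous.continuousOn (by fun_prop)).smul
      ((T.continuousOn_orbit v).mono Set.Icc_subset_Ici_self))
    (fun s hs => by
      have hderiv := (hasDerivAt_exp_mul_ofReal (-l) s).hasDerivWithinAt.smul
        ((hasDerivAtZero_generator v).hasDerivWithinAt_op hs.1)
      rwa [hv, map_smul, smul_smul, ← add_smul, ← mul_add, add_neg_cancel, mul_zero,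
        zero_smul] at hderiv)
    t ⟨ht, le_rfl⟩
  simp only [Complex.ofReal_zero, mul_zero, Complex.exp_zero, one_smul, T.op_zero_apply] at hconst
  conv_rhs => rw [← hconst, smul_smul, ← Complex.exp_add]
  simp

end Orbits

section Laplace

variable {ω : ℝ} {z : ℂ}

/-- `ω` is an exponential growth bound of the semigroup: `‖T(t)‖ ≤ M e^{ωt}` for some `M`. -/
def HasGrowthBound (T : C0Semigroup E) (ω : ℝ) : Prop :=
  ∃ M : ℝ, ∀ t, 0 ≤ t → ‖T.op t‖ ≤ M * Real.exp (ω * t)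

/-- The Laplace transform of the orbit of `f`; it is `0` where the integral does not converge
absolutely. -/
noncomputable def laplace (T : C0Semigroup E) (z : ℂ) (f : E) : E :=
  ∫ t in Set.Ioi (0 : ℝ), Complex.exp (-z * t) • T.op t f

theorem norm_op_natCast_add_le {M t : ℝ} (hM : ∀ t ∈ Set.Icc (0 : ℝ) 1, ‖T.op t‖ ≤ M)
    (n : ℕ) (ht : t ∈ Set.Icc (0 : ℝ) 1) : ‖T.op (n + t)‖ ≤ M ^ (n + 1) := by
  induction n with
  | zero => simpa using hM t ht
  | succ n ih =>
    rw [show ((n + 1 : ℕ) : ℝ) + t = 1 + (n + t) by push_cast; ring,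
      T.op_add 1 (n + t) zero_le_one (add_nonneg n.cast_nonneg ht.1), pow_succ']
    exact (ContinuousLinearMap.opNorm_comp_le _ _).trans
      (mul_le_mul (hM 1 ⟨zero_le_one, le_rfl⟩) ih (norm_nonneg _)
        ((norm_nonneg _).trans (hM t ht)))

theorem HasGrowthBound.exists_norm_exp_smul_op_le (h : T.HasGrowthBound ω) (z : ℂ) :
    ∃ M, ∀ f, ∀ t ∈ Set.Ioi (0 : ℝ),
      ‖Complex.exp (-z * t) • T.op t f‖ ≤ M * ‖f‖ * Real.exp (-(z.re - ω) * t) := by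
  obtain ⟨M, hM⟩ := h
  refine ⟨M, fun f t (ht : 0 < t) => ?_⟩
  calc ‖Complex.exp (-z * t) • T.op t f‖ = Real.exp (-z.re * t) * ‖T.op t f‖ := by
        simp [norm_smul, Complex.norm_exp]
    _ ≤ Real.exp (-z.re * t) * (M * Real.exp (ω * t) * ‖f‖) := by
        gcongr
        exact (T.op t).le_of_opNorm_le (hM t ht.le) f
    _ = M * ‖f‖ * Real.exp (-z.re * t + ω * t) := by rw [Real.exp_add]; ring
    _ = M * ‖f‖ * Real.exp (-(z.re - ω) * t) := by ring_nf

theorem continuousOn_exp_smul_op (T : C0Semigroup E) (z : ℂ) (f : E) :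
    ContinuousOn (fun t : ℝ => Complex.exp (-z * t) • T.op t f) (Set.Ici 0) :=
  (Continuous.continuousOn (by fun_prop)).smul (T.continuousOn_orbit f)

theorem HasGrowthBound.integrableOn_exp_smul_op (h : T.HasGrowthBound ω) (hz : ω < z.re) (f : E) :
    IntegrableOn (fun t : ℝ => Complex.exp (-z * t) • T.op t f) (Set.Ioi 0) := by
  obtain ⟨M, hM⟩ := h.exists_norm_exp_smul_op_le z
  exact ((exp_neg_integrableOn_Ioi 0 (sub_pos.2 hz)).const_mul (M * ‖f‖)).mono'
    (((T.continuousOn_exp_smul_op z f).mono Set.Ioi_subset_Ici_self).aestronglyMeasurable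
      measurableSet_Ioi)
    ((ae_restrict_iff' measurableSet_Ioi).2 (ae_of_all _ (hM f)))

theorem HasGrowthBound.exists_clm_apply_eq_laplace (h : T.HasGrowthBound ω) (hz : ω < z.re) :
    ∃ R : E →L[ℂ] E, ∀ f, R f = T.laplace z f := by
  obtain ⟨M, hM⟩ := h.exists_norm_exp_smul_op_le z
  refine ⟨LinearMap.mkContinuous ⟨⟨T.laplace z, fun f g => ?_⟩, fun c f => ?_⟩
    (M * ∫ t in Set.Ioi (0 : ℝ), Real.exp (-(z.re - ω) * t)) fun f => ?_, fun f => rfl⟩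
  · simp only [laplace, map_add, smul_add]
    exact integral_add (h.integrableOn_exp_smul_op hz f) (h.integrableOn_exp_smul_op hz g)
  · simp only [laplace, map_smul, smul_comm _ c]
    exact integral_smul c _
  · refine (norm_integral_le_of_norm_le ((exp_neg_integrableOn_Ioi 0 (sub_pos.2 hz)).const_mul
      (M * ‖f‖)) ((ae_restrict_iff' measurableSet_Ioi).2 (ae_of_all _ (hM f)))).trans_eq ?_
    rw [integral_const_mul]
    ring

variable [CompleteSpace E]

theorem exists_hasGrowthBound (T : C0Semigroup E) : ∃ ω, T.HasGrowthBound ω := by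
  obtain ⟨M₀, hM₀⟩ := banach_steinhaus (g := fun t : Set.Icc (0 : ℝ) 1 => T.op t) fun x => by
    obtain ⟨C, hC⟩ := isCompact_Icc.exists_bound_of_continuousOn
      ((T.continuousOn_orbit x).mono Set.Icc_subset_Ici_self)
    exact ⟨C, fun t => hC t t.2⟩
  have hM1 : 1 ≤ max M₀ 1 := le_max_right _ _
  refine ⟨Real.log (max M₀ 1), max M₀ 1, fun t ht => ?_⟩
  have hfloor := norm_op_natCast_add_le (fun t ht => (hM₀ ⟨t, ht⟩).trans (le_max_left _ 1)) ⌊t⌋₊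
    ⟨sub_nonneg.2 (Nat.floor_le ht), sub_le_iff_le_add'.2 (Nat.lt_floor_add_one t).le⟩
  rw [add_sub_cancel] at hfloor
  refine hfloor.trans ?_
  rw [pow_succ', ← Real.rpow_natCast, Real.rpow_def_of_pos (by positivity)]
  gcongr
  · exact Real.log_nonneg hM1
  · exact Nat.floor_le ht

theorem HasGrowthBound.op_laplace (h : T.HasGrowthBound ω) (hz : ω < z.re) {s : ℝ} (hs : 0 ≤ s)
    (f : E) : T.op s (T.laplace z f) = T.laplace z (T.op s f) := by
  rw [laplace, ← ContinuousLinearMap.integral_comp_comm _ (h.integrableOn_exp_smul_op hz f)]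
  refine setIntegral_congr_fun measurableSet_Ioi fun t (ht : 0 < t) => ?_
  simp only [map_smul]
  rw [T.op_comm hs ht.le]

theorem HasGrowthBound.op_laplace_eq_exp_smul (h : T.HasGrowthBound ω) (hz : ω < z.re) {s : ℝ}
    (hs : 0 ≤ s) (f : E) : T.op s (T.laplace z f) =
      Complex.exp (z * s) •
        (T.laplace z f - ∫ t in (0 : ℝ)..s, Complex.exp (-z * t) • T.op t f) := by
  have htranslate : ∫ t in Set.Ioi s, Complex.exp (-z * t) • T.op t f =
      ∫ t in Set.Ioi (0 : ℝ), Complex.exp (-z * (t + s : ℝ)) • T.op (t + s) f := by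
    rw [← (measurePreserving_add_right volume s).setIntegral_preimage_emb
      (MeasurableEquiv.addRight s).measurableEmbedding]
    simp
  rw [h.op_laplace hz hs, laplace, laplace,
    ← intervalIntegral.integral_Ioi_sub_Ioi (h.integrableOn_exp_smul_op hz f) hs, sub_sub_cancel,
    htranslate, ← integral_smul]
  refine setIntegral_congr_fun measurableSet_Ioi fun t (ht : 0 < t) => ?_
  simp only [Complex.ofReal_add, smul_smul, ← Complex.exp_add, T.op_add_apply ht.le hs]
  ring_nf

theorem HasGrowthBound.hasDerivAtZero_laplace (h : T.HasGrowthBound ω) (hz : ω < z.re) (f : E) :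
    T.HasDerivAtZero (T.laplace z f) (z • T.laplace z f - f) := by
  have hcont := T.continuousOn_exp_smul_op z f
  have hint : HasDerivWithinAt (fun s => ∫ t in (0 : ℝ)..s, Complex.exp (-z * t) • T.op t f)
      (Complex.exp (-z * (0 : ℝ)) • T.op 0 f) (Set.Ici 0) 0 :=
    intervalIntegral.integral_hasDerivWithinAt_right IntervalIntegrable.refl
      ⟨Set.Ioi 0, self_mem_nhdsWithin,
        (hcont.mono Set.Ioi_subset_Ici_self).aestronglyMeasurable measurableSet_Ioi⟩
      ((hcont 0 Set.self_mem_Ici).mono Set.Ioi_subset_Ici_self)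
  have hderiv := (hasDerivAt_exp_mul_ofReal z 0).hasDerivWithinAt.smul
    ((hint.mono Set.Ioi_subset_Ici_self).const_sub (T.laplace z f))
  rw [hasDerivWithinAt_iff_tendsto_slope' Set.self_notMem_Ioi] at hderiv
  simp only [Complex.ofReal_zero, mul_zero, Complex.exp_zero, one_smul, one_mul,
    intervalIntegral.integral_same, sub_zero, op_zero_apply, neg_add_eq_sub] at hderiv
  refine hderiv.congr' ?_
  filter_upwards [self_mem_nhdsWithin] with s (hs : 0 < s)
  rw [h.op_laplace_eq_exp_smul hz hs.le, slope_def_module, ← Complex.ofReal_inv, Complex.coe_smul]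
  simp

theorem HasGrowthBound.exists_isResolventAt (h : T.HasGrowthBound ω) (hz : ω < z.re) :
    ∃ R, IsResolventAt T.generator z R ∧ ∀ f, R f = T.laplace z f := by
  obtain ⟨R, hR⟩ := h.exists_clm_apply_eq_laplace hz
  have hderiv : ∀ f, T.HasDerivAtZero (R f) (z • R f - f) := fun f => by
    rw [hR]
    exact h.hasDerivAtZero_laplace hz f
  refine ⟨R, ⟨fun v => ?_, fun y => ?_⟩, hR⟩
  · have hRv := (hasDerivAtZero_generator v).map (S := R)
      fun t ht f => by rw [hR, hR, h.op_laplace hz ht]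
    rw [scalarSub_apply, map_sub, map_smul, hRv.unique (hderiv v), sub_sub_cancel]
  · obtain ⟨v, hv, hv'⟩ := (hderiv y).exists_generator
    exact ⟨v, hv, by rw [scalarSub_apply, hv, hv', sub_sub_cancel]⟩

theorem HasGrowthBound.mem_resolventSet (h : T.HasGrowthBound ω) (hz : ω < z.re) :
    z ∈ resolventSet T.generator :=
  (h.exists_isResolventAt hz).imp fun _ hR => hR.1

theorem HasGrowthBound.resolvent_apply (h : T.HasGrowthBound ω) (hz : ω < z.re) (f : E) :
    resolvent T.generator z f = T.laplace z f := by
  obtain ⟨R, hR, hRf⟩ := h.exists_isResolventAt hz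
  rw [hR.resolvent_eq, hRf]

end Laplace

end C0Semigroup

section Landau

open MeasureTheory ProbabilityTheory
open scoped Nat

variable {Ω : Type*} {m : MeasurableSpace Ω} {μ : Measure Ω}

theorem integrable_of_hasSum_of_nonneg {ι : Type*} [Countable ι] {f : ι → Ω → ℝ} {F : Ω → ℝ}
    (hf : ∀ i, Integrable (f i) μ) (hf0 : ∀ i, 0 ≤ᵐ[μ] f i)
    (hs : Summable fun i => ∫ ω, f i ω ∂μ) (hF : ∀ᵐ ω ∂μ, HasSum (fun i => f i ω) (F ω)) :
    Integrable F μ := by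
  have hFf : F =ᵐ[μ] fun ω => (∑' i, ENNReal.ofReal (f i ω)).toReal := by
    filter_upwards [ae_all_iff.2 hf0, hF] with ω h0 hω
    rw [← ENNReal.ofReal_tsum_of_nonneg h0 hω.summable, hω.tsum_eq,
      ENNReal.toReal_ofReal (hω.nonneg h0)]
  have hfm : ∀ i, AEMeasurable (fun ω => ENNReal.ofReal (f i ω)) μ := fun i =>
    (hf i).aemeasurable.ennreal_ofReal
  refine (integrable_toReal_of_lintegral_ne_top (.tsum hfm) ?_).congr hFf.symm
  simp_rw [lintegral_tsum hfm, ← ofReal_integral_eq_lintegral_ofReal (hf _) (hf0 _)]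
  rw [← ENNReal.ofReal_tsum_of_nonneg (fun i => integral_nonneg_of_ae (hf0 i)) hs]
  exact ENNReal.ofReal_ne_top

theorem hasSum_pow_mul_exp (c d x : ℝ) :
    HasSum (fun n : ℕ => (n ! : ℝ)⁻¹ * (d - c) ^ n * (x ^ n * Real.exp (c * x)))
      (Real.exp (d * x)) := by
  have h := (NormedSpace.expSeries_div_hasSum_exp ((d - c) * x)).mul_right (Real.exp (c * x))
  rw [← Real.exp_eq_exp_ℝ, ← Real.exp_add, ← add_mul, sub_add_cancel] at h
  exact h.congr_fun fun n => by rw [mul_pow]; ring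

variable {X : Ω → ℝ}

theorem mem_integrableExpSet_of_le (hXm : AEMeasurable X μ) (hX : ∀ᵐ ω ∂μ, X ω ≤ 0) {x y : ℝ}
    (hx : x ∈ integrableExpSet X μ) (hxy : x ≤ y) : y ∈ integrableExpSet X μ := by
  refine hx.mono' (hXm.const_mul y).exp.aestronglyMeasurable ?_
  filter_upwards [hX] with ω hω
  rw [Real.norm_of_nonneg (Real.exp_pos _).le]
  exact Real.exp_le_exp.2 (mul_le_mul_of_nonpos_right hxy hω)

-- Landau's trick: since `X ≤ 0`, to the left of `c` all terms of the Taylor series at `c` are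
-- integrals of nonnegative functions, so that its convergence forces integrability.
theorem mem_integrableExpSet_of_summable (hX : ∀ᵐ ω ∂μ, X ω ≤ 0) {c d : ℝ} (hdc : d ≤ c)
    (hc : c ∈ interior (integrableExpSet X μ))
    (hs : Summable fun n : ℕ => (n ! : ℂ)⁻¹ • ((d : ℂ) - c) ^ n •
      iteratedDeriv n (complexMGF X μ) c) :
    d ∈ integrableExpSet X μ := by
  refine integrable_of_hasSum_of_nonneg
    (fun n => (integrable_pow_mul_exp_of_mem_interior_integrableExpSet hc n).const_mul _)
    (fun n => ?_) (Complex.summable_ofReal.1 (hs.congr fun n => ?_))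
    (ae_of_all _ fun ω => hasSum_pow_mul_exp c d (X ω))
  · filter_upwards [hX] with ω hω
    have hpow : 0 ≤ ((d - c) * X ω) ^ n :=
      pow_nonneg (mul_nonneg_of_nonpos_of_nonpos (sub_nonpos.2 hdc) hω) n
    calc (0 : ℝ) ≤ (n ! : ℝ)⁻¹ * ((d - c) * X ω) ^ n * Real.exp (c * X ω) := by positivity
      _ = (n ! : ℝ)⁻¹ * (d - c) ^ n * (X ω ^ n * Real.exp (c * X ω)) := by rw [mul_pow]; ring
  · rw [iteratedDeriv_complexMGF (by simpa using hc), integral_const_mul, Complex.ofReal_mul,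
      ← integral_complex_ofReal]
    simp [mul_assoc]

theorem exists_lt_mem_integrableExpSet_of_analyticAt (hX : ∀ᵐ ω ∂μ, X ω ≤ 0) {H : ℂ → ℂ} {b : ℝ}
    (hb : Set.Ioi b ⊆ integrableExpSet X μ) (hH : AnalyticAt ℂ H b)
    (hHX : ∀ᶠ z : ℂ in 𝓝 b, b < z.re → H z = complexMGF X μ z) :
    ∃ d < b, d ∈ integrableExpSet X μ := by
  obtain ⟨ε, hε, hball⟩ :=
    Metric.eventually_nhds_iff_ball.1 (hH.eventually_analyticAt.and hHX)
  set c := b + ε / 4 with hc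
  set d := b - ε / 8 with hd
  have hdist : ∀ x y : ℝ, dist (x : ℂ) y = |x - y| := fun x y => by
    rw [Complex.dist_eq, ← Complex.ofReal_sub, Complex.norm_real, Real.norm_eq_abs]
  have hsub : Metric.ball (c : ℂ) (ε / 2) ⊆ Metric.ball b ε := by
    refine Metric.ball_subset_ball' ?_
    rw [hdist, hc, add_sub_cancel_left, abs_of_pos (by positivity)]
    linarith
  have hdc : (d : ℂ) ∈ Metric.ball (c : ℂ) (ε / 2) := by
    rw [Metric.mem_ball, hdist, abs_lt]
    constructor <;> linarith
  have hbc : b < c := by linarith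
  have heq : H =ᶠ[𝓝 (c : ℂ)] complexMGF X μ := by
    filter_upwards [Metric.isOpen_ball.mem_nhds (Metric.mem_ball_self (half_pos hε)),
      Complex.continuous_re.continuousAt.eventually_const_lt (show b < (c : ℂ).re from hbc)]
      with z hz hbz
    exact (hball z (hsub hz)).2 hbz
  have hseries := Complex.hasSum_taylorSeries_on_ball
    (fun z hz => (hball z (hsub hz)).1.differentiableAt.differentiableWithinAt) hdc
  refine ⟨d, by linarith, mem_integrableExpSet_of_summable hX (by linarith)
    (interior_maximal hb isOpen_Ioi hbc) (hseries.summable.congr fun n => ?_)⟩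
  rw [heq.iteratedDeriv_eq n]

theorem eq_complexMGF_of_re_gt {H : ℂ → ℂ} {a x₀ : ℝ} (hH : MeromorphicOn H {z | a < z.re})
    (ha : Set.Ioi a ⊆ integrableExpSet X μ) (hHX : ∀ z : ℂ, x₀ < z.re → H z = complexMGF X μ z)
    {z : ℂ} (hz : a < z.re) (hHz : AnalyticAt ℂ H z) : H z = complexMGF X μ z := by
  have hX : ∀ w : ℂ, a < w.re → AnalyticAt ℂ (complexMGF X μ) w := fun w hw =>
    analyticAt_complexMGF (interior_maximal ha isOpen_Ioi hw)
  have hre : x₀ < ((max a x₀ + 1 : ℝ) : ℂ).re := (le_max_right a x₀).trans_lt (lt_add_one _)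
  have hpunctured : H =ᶠ[𝓝[≠] z] complexMGF X μ :=
    eventuallyEq_nhdsNE_of_isPreconnected (convex_halfSpace_re_gt a).isPreconnected hH
      (fun w hw => (hX w hw).meromorphicAt)
      ⟨(max a x₀ + 1 : ℝ), (le_max_left a x₀).trans_lt (lt_add_one _),
        ((Complex.continuous_re.continuousAt.eventually_const_lt hre).filter_mono
          nhdsWithin_le_nhds |>.mono fun w hw => hHX w hw).frequently⟩ z hz
  exact ((hHz.frequently_eq_iff_eventually_eq (hX z hz)).1 hpunctured.frequently).self_of_nhds

theorem Ioi_subset_integrableExpSet_of_meromorphicOn (hX : ∀ᵐ ω ∂μ, X ω ≤ 0) {H : ℂ → ℂ}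
    {a x₀ : ℝ} (hH : MeromorphicOn H {z | a < z.re}) (hHa : ∀ x : ℝ, a < x → AnalyticAt ℂ H x)
    (hx₀ : Set.Ioi x₀ ⊆ integrableExpSet X μ)
    (hHX : ∀ z : ℂ, x₀ < z.re → H z = complexMGF X μ z) :
    Set.Ioi a ⊆ integrableExpSet X μ := by
  have hXm : AEMeasurable X μ := aemeasurable_of_mem_interior_integrableExpSet
    (interior_maximal hx₀ isOpen_Ioi (lt_add_one x₀))
  intro x hx
  by_contra hxS
  have hlower : x ∈ lowerBounds (integrableExpSet X μ) := fun y hy =>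
    le_of_not_ge fun hyx => hxS (mem_integrableExpSet_of_le hXm hX hy hyx)
  have hne : (integrableExpSet X μ).Nonempty := ⟨x₀ + 1, hx₀ (lt_add_one x₀)⟩
  have hab : a < sInf (integrableExpSet X μ) := lt_of_lt_of_le hx (le_csInf hne hlower)
  set b := sInf (integrableExpSet X μ)
  have hb : Set.Ioi b ⊆ integrableExpSet X μ := fun y hy => by
    obtain ⟨x, hx, hxy⟩ := (csInf_lt_iff ⟨x, hlower⟩ hne).1 hy
    exact mem_integrableExpSet_of_le hXm hX hx hxy.le
  obtain ⟨d, hdb, hd⟩ := exists_lt_mem_integrableExpSet_of_analyticAt hX hb (hHa b hab) <| by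
    filter_upwards [(hHa b hab).eventually_analyticAt] with z hz hbz
    exact eq_complexMGF_of_re_gt (hH.mono_set fun w hw => hab.trans hw) hb hHX hbz hz
  exact (csInf_le ⟨x, hlower⟩ hd).not_gt hdb

end Landau

namespace C0Semigroup

open MeasureTheory ProbabilityTheory UnboundedOperator
open scoped ComplexOrder

variable {E : Type*} [NormedAddCommGroup E] [NormedSpace ℂ E] {T : C0Semigroup E} {Ψ : E →L[ℂ] ℂ}
  {f : E} {a ω : ℝ} {z : ℂ}

section OrbitMeasure

/-- The measure on `(0, ∞)` whose density at time `t` is `Ψ (T(t) f)`, meaningful when these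
numbers are nonnegative. The value at `z` of its Laplace transform is then `Ψ (R(z, A) f)` for
large `Re z`; in Mathlib's terms it is the complex moment generating function of `t ↦ -t`. -/
noncomputable def orbitMeasure (T : C0Semigroup E) (Ψ : E →L[ℂ] ℂ) (f : E) : Measure ℝ :=
  (volume.restrict (Set.Ioi 0)).withDensity fun t => (Ψ (T.op t f)).re.toNNReal

theorem ae_orbitMeasure_neg_nonpos : ∀ᵐ t ∂T.orbitMeasure Ψ f, -t ≤ 0 :=
  (withDensity_absolutelyContinuous _ _).ae_le ((ae_restrict_iff' measurableSet_Ioi).2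
    (ae_of_all _ fun _ ht => neg_nonpos.2 ht.le))

theorem aemeasurable_toNNReal_re_orbit (T : C0Semigroup E) (Ψ : E →L[ℂ] ℂ) (f : E) :
    AEMeasurable (fun t => (Ψ (T.op t f)).re.toNNReal) (volume.restrict (Set.Ioi 0)) :=
  ((Complex.continuous_re.comp Ψ.continuous).comp_continuousOn ((T.continuousOn_orbit f).mono
    Set.Ioi_subset_Ici_self)).aemeasurable measurableSet_Ioi |>.real_toNNReal

theorem toNNReal_re_smul_exp (hf : ∀ t, 0 ≤ t → 0 ≤ Ψ (T.op t f)) (z : ℂ) {t : ℝ} (ht : 0 < t) :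
    (Ψ (T.op t f)).re.toNNReal • Complex.exp (z * (-t : ℝ)) =
      Ψ (Complex.exp (-z * t) • T.op t f) := by
  rw [NNReal.smul_def, Real.coe_toNNReal _ (Complex.nonneg_iff.1 (hf t ht.le)).1, Complex.real_smul,
    ← Complex.eq_re_of_ofReal_le (hf t ht.le), map_smul, smul_eq_mul, mul_comm]
  simp

theorem HasGrowthBound.Ioi_subset_integrableExpSet (h : T.HasGrowthBound ω)
    (hf : ∀ t, 0 ≤ t → 0 ≤ Ψ (T.op t f)) :
    Set.Ioi ω ⊆ integrableExpSet (fun t => -t) (T.orbitMeasure Ψ f) := fun x hx => by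
  have hint : Integrable (fun t : ℝ => Complex.exp (x * (-t : ℝ))) (T.orbitMeasure Ψ f) :=
    (integrable_withDensity_iff_integrable_smul₀ (T.aemeasurable_toNNReal_re_orbit Ψ f)).2 <|
      IntegrableOn.congr_fun (Ψ.integrable_comp (h.integrableOn_exp_smul_op (z := x) hx f))
        (fun t ht => (toNNReal_re_smul_exp hf x ht).symm) measurableSet_Ioi
  exact hint.re.congr (ae_of_all _ fun t => by
    simp only [← Complex.ofReal_mul, ← Complex.ofReal_exp, RCLike.re_to_complex,
      Complex.ofReal_re])

variable [CompleteSpace E]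

theorem HasGrowthBound.apply_resolvent_eq_complexMGF (h : T.HasGrowthBound ω)
    (hf : ∀ t, 0 ≤ t → 0 ≤ Ψ (T.op t f)) (hz : ω < z.re) :
    Ψ (resolvent T.generator z f) = complexMGF (fun t => -t) (T.orbitMeasure Ψ f) z := by
  rw [h.resolvent_apply hz, laplace,
    ← ContinuousLinearMap.integral_comp_comm _ (h.integrableOn_exp_smul_op hz f), complexMGF,
    orbitMeasure, integral_withDensity_eq_integral_smul₀ (T.aemeasurable_toNNReal_re_orbit Ψ f)]
  exact setIntegral_congr_fun measurableSet_Ioi fun t ht => (toNNReal_re_smul_exp hf z ht).symm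

end OrbitMeasure

section PositiveOrbit

variable [CompleteSpace E] (hf : ∀ t, 0 ≤ t → 0 ≤ Ψ (T.op t f))
  (hmero : MeromorphicOn (resolvent T.generator) {z | a < z.re})
  (hreal : ∀ x : ℝ, a < x → (x : ℂ) ∈ resolventSet T.generator)

include hf hmero hreal

theorem Ioi_subset_integrableExpSet_orbitMeasure :
    Set.Ioi a ⊆ integrableExpSet (fun t => -t) (T.orbitMeasure Ψ f) := by
  obtain ⟨ω, hω⟩ := T.exists_hasGrowthBound
  exact Ioi_subset_integrableExpSet_of_meromorphicOn ae_orbitMeasure_neg_nonpos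
    (fun z hz => meromorphicAt_apply_resolvent Ψ f (hmero z hz))
    (fun x hx => analyticAt_apply_resolvent Ψ f (hreal x hx))
    (hω.Ioi_subset_integrableExpSet hf) fun z hz => hω.apply_resolvent_eq_complexMGF hf hz

theorem apply_resolvent_eq_complexMGF (hz : a < z.re) (hzρ : z ∈ resolventSet T.generator) :
    Ψ (resolvent T.generator z f) = complexMGF (fun t => -t) (T.orbitMeasure Ψ f) z := by
  obtain ⟨ω, hω⟩ := T.exists_hasGrowthBound
  exact eq_complexMGF_of_re_gt
    (fun z hz => meromorphicAt_apply_resolvent Ψ f (hmero z hz))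
    (Ioi_subset_integrableExpSet_orbitMeasure hf hmero hreal)
    (fun w hw => hω.apply_resolvent_eq_complexMGF hf hw) hz
    (analyticAt_apply_resolvent Ψ f hzρ)

theorem apply_resolvent_ofReal_nonneg {x : ℝ} (hx : a < x) :
    0 ≤ Ψ (resolvent T.generator x f) := by
  rw [apply_resolvent_eq_complexMGF hf hmero hreal hx (hreal x hx), complexMGF_ofReal]
  exact Complex.zero_le_real.2 mgf_nonneg

theorem norm_apply_resolvent_le (hz : a < z.re) (hzρ : z ∈ resolventSet T.generator) :
    ‖Ψ (resolvent T.generator z f)‖ ≤ ‖Ψ (resolvent T.generator z.re f)‖ := by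
  rw [apply_resolvent_eq_complexMGF hf hmero hreal hz hzρ,
    apply_resolvent_eq_complexMGF (z := z.re) hf hmero hreal hz (hreal z.re hz), complexMGF_ofReal,
    Complex.norm_real, Real.norm_of_nonneg mgf_nonneg]
  exact norm_complexMGF_le_mgf

end PositiveOrbit

section LeadingCoeff

variable {l : ℂ} {k m : ℕ} {Q Q₀ : E →L[ℂ] E}

theorem leadingCoeff_apply_op (hQ : IsLeadingCoeff T.generator l k Q) (hk : k ≠ 0)
    (hl : ∀ᶠ z in 𝓝[≠] l, z ∈ resolventSet T.generator) {t : ℝ} (ht : 0 ≤ t) (f : E) :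
    Q (T.op t f) = Complex.exp (l * t) • Q f := by
  obtain ⟨v, hv, hAv⟩ := hQ.exists_eigenvector hk hl f
  rw [← hv, ← op_apply_of_generator_apply_eq_smul hAv ht, hv]
  exact DFunLike.congr_fun (hQ.commute (hl.mono fun z hz => resolvent_op_commute hz ht)).eq f

theorem exists_forall_op_op_nonneg (hf : ∀ᶠ t in atTop, 0 ≤ Ψ (T.op t f)) :
    ∃ τ, 0 ≤ τ ∧ ∀ t, 0 ≤ t → 0 ≤ Ψ (T.op t (T.op τ f)) := by
  obtain ⟨τ, hτ⟩ := eventually_atTop.1 hf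
  refine ⟨max τ 0, le_max_right τ 0, fun t ht => ?_⟩
  rw [← T.op_add_apply ht (le_max_right τ 0)]
  exact hτ _ (by linarith [le_max_left τ 0])

variable [CompleteSpace E]

theorem leadingCoeff_apply_eq_zero_of_lt_re (hf : ∀ᶠ t in atTop, 0 ≤ Ψ (T.op t f))
    (hmero : MeromorphicOn (resolvent T.generator) {z | a < z.re})
    (hreal : ∀ x : ℝ, a < x → (x : ℂ) ∈ resolventSet T.generator) (hal : a < l.re)
    (hQ : IsLeadingCoeff T.generator l k Q) (hk : k ≠ 0)
    (hl : ∀ᶠ z in 𝓝[≠] l, z ∈ resolventSet T.generator) : Ψ (Q f) = 0 := by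
  obtain ⟨τ, hτ0, hτ⟩ := exists_forall_op_op_nonneg hf
  have hcont : ContinuousAt (complexMGF (fun t => -t) (T.orbitMeasure Ψ (T.op τ f))) l :=
    (analyticAt_complexMGF (interior_maximal
      (Ioi_subset_integrableExpSet_orbitMeasure hτ hmero hreal) isOpen_Ioi hal)).continuousAt
  have hpow : Tendsto (fun z => (z - l) ^ k) (𝓝 l) (𝓝 0) :=
    Continuous.tendsto' (by fun_prop) l 0 (by simp [hk])
  have hzero := ((hpow.mul hcont).mono_left nhdsWithin_le_nhds).congr' <|
    (hl.and (nhdsWithin_le_nhds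
      (Complex.continuous_re.continuousAt.eventually_const_lt hal))).mono fun z hz => by
        rw [← apply_resolvent_eq_complexMGF hτ hmero hreal hz.2 hz.1, ← smul_eq_mul, ← map_smul]
  have hQτ := tendsto_nhds_unique ((Ψ.continuous.tendsto _).comp (hQ.tendsto_apply (T.op τ f)))
    hzero
  rw [zero_mul, leadingCoeff_apply_op hQ hk hl hτ0, map_smul, smul_eq_zero] at hQτ
  exact hQτ.resolve_left (Complex.exp_ne_zero _)

theorem leadingCoeff_apply_nonneg {s : ℝ} (hf : ∀ᶠ t in atTop, 0 ≤ Ψ (T.op t f))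
    (hmero : MeromorphicOn (resolvent T.generator) {z | s < z.re})
    (hreal : ∀ x : ℝ, s < x → (x : ℂ) ∈ resolventSet T.generator)
    (hQ : IsLeadingCoeff T.generator s k Q) (hk : k ≠ 0)
    (hs : ∀ᶠ z in 𝓝[≠] (s : ℂ), z ∈ resolventSet T.generator) : 0 ≤ Ψ (Q f) := by
  obtain ⟨τ, hτ0, hτ⟩ := exists_forall_op_op_nonneg hf
  have hQτ : 0 ≤ Ψ (Q (T.op τ f)) := by
    refine ge_of_tendsto (hQ.tendsto_apply_add_ofReal Ψ (T.op τ f)) ?_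
    filter_upwards [self_mem_nhdsWithin] with ε (hε : 0 < ε)
    rw [← Complex.ofReal_add, ← Complex.ofReal_pow]
    exact mul_nonneg (Complex.zero_le_real.2 (pow_nonneg hε.le k))
      (apply_resolvent_ofReal_nonneg hτ hmero hreal (lt_add_of_pos_right s hε))
  rw [leadingCoeff_apply_op hQ hk hs hτ0, map_smul, smul_eq_mul, ← Complex.ofReal_mul,
    ← Complex.ofReal_exp, ← Complex.real_smul] at hQτ
  exact (smul_nonneg_iff_nonneg_of_pos_left (Real.exp_pos _)).1 hQτ

theorem leadingCoeff_apply_eq_zero_of_lt_order {s : ℝ} (hf : ∀ᶠ t in atTop, 0 ≤ Ψ (T.op t f))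
    (hmero : MeromorphicOn (resolvent T.generator) {z | s < z.re})
    (hright : ∀ z : ℂ, s < z.re → z ∈ resolventSet T.generator)
    (hQ₀ : IsLeadingCoeff T.generator s m Q₀) (hls : l.re = s) (hmk : m < k)
    (hQ : IsLeadingCoeff T.generator l k Q)
    (hl : ∀ᶠ z in 𝓝[≠] l, z ∈ resolventSet T.generator) : Ψ (Q f) = 0 := by
  obtain ⟨τ, hτ0, hτ⟩ := exists_forall_op_op_nonneg hf
  have hpow : Tendsto (fun ε : ℝ => ε ^ (k - m)) (𝓝[>] 0) (𝓝 0) :=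
    (Continuous.tendsto' (by fun_prop) 0 0 (by simp; omega)).mono_left nhdsWithin_le_nhds
  have hzero := hpow.mul (hQ₀.tendsto_apply_add_ofReal Ψ (T.op τ f)).norm
  have hQτ : ‖Ψ (Q (T.op τ f))‖ ≤ 0 * ‖Ψ (Q₀ (T.op τ f))‖ := by
    refine le_of_tendsto_of_tendsto (hQ.tendsto_apply_add_ofReal Ψ (T.op τ f)).norm hzero ?_
    filter_upwards [self_mem_nhdsWithin] with ε (hε : 0 < ε)
    have hre : (l + ε : ℂ).re = s + ε := by simp [hls]
    have hlt : s < (l + ε : ℂ).re := by linarith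
    have hle := norm_apply_resolvent_le hτ hmero (fun x hx => hright x hx) hlt (hright _ hlt)
    rw [hre, Complex.ofReal_add] at hle
    calc ‖(ε : ℂ) ^ k * Ψ (resolvent T.generator (l + ε) (T.op τ f))‖
        = ε ^ k * ‖Ψ (resolvent T.generator (l + ε) (T.op τ f))‖ := by simp [abs_of_pos hε]
      _ ≤ ε ^ k * ‖Ψ (resolvent T.generator (s + ε) (T.op τ f))‖ := by gcongr
      _ = ε ^ (k - m) * ‖(ε : ℂ) ^ m * Ψ (resolvent T.generator (s + ε) (T.op τ f))‖ := by
        rw [norm_mul, ← mul_assoc, norm_pow, Complex.norm_real, Real.norm_of_nonneg hε.le,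
          ← pow_add, Nat.sub_add_cancel hmk.le]
  rw [zero_mul, norm_le_zero_iff, leadingCoeff_apply_op hQ (by omega) hl hτ0, map_smul,
    smul_eq_zero] at hQτ
  exact hQτ.resolve_left (Complex.exp_ne_zero _)

end LeadingCoeff

end C0Semigroup

namespace C0Semigroup

open UnboundedOperator
open scoped ComplexOrder

variable {E : Type*} [NormedAddCommGroup E] [NormedSpace ℂ E] {T : C0Semigroup E}

section SpectralBound

variable [CompleteSpace E]

theorem spectralBound_lt_top (T : C0Semigroup E) : spectralBound T.generator < ⊤ := by
  obtain ⟨ω, hω⟩ := T.exists_hasGrowthBound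
  refine lt_of_le_of_lt (iSup₂_le fun l hl => ?_) (EReal.coe_lt_top ω)
  exact EReal.coe_le_coe_iff.2 (le_of_not_gt fun hlt => hl (hω.mem_resolventSet hlt))

variable {C : Set E} {𝓕 : Set (E →L[ℂ] ℂ)} {a s : ℝ} {l : ℂ} {k m : ℕ}
  (hspan : Dense (Submodule.span ℂ C : Set E)) (hsep : ∀ z, (∀ Ψ ∈ 𝓕, Ψ z = 0) → z = 0)
  (hpos : ∀ Ψ ∈ 𝓕, ∀ f ∈ C, ∀ᶠ t in atTop, 0 ≤ Ψ (T.op t f))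

include hspan hsep in
omit [CompleteSpace E] in
theorem clm_eq_zero_of_forall_apply_eq_zero {Q : E →L[ℂ] E}
    (hQ : ∀ Ψ ∈ 𝓕, ∀ f ∈ C, Ψ (Q f) = 0) : Q = 0 :=
  ContinuousLinearMap.ext_on hspan fun f hf => hsep (Q f) fun Ψ hΨ => hQ Ψ hΨ f hf

include hspan hsep hpos

theorem not_isResolventPole_of_lt_re
    (hmero : MeromorphicOn (resolvent T.generator) {z | a < z.re})
    (hreal : ∀ x : ℝ, a < x → (x : ℂ) ∈ resolventSet T.generator) (hal : a < l.re) :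
    ¬ IsResolventPole T.generator l k := fun hl => by
  obtain ⟨Q, hQ0, hQ⟩ := hl.exists_isLeadingCoeff
  exact hQ0 (clm_eq_zero_of_forall_apply_eq_zero hspan hsep fun Ψ hΨ f hf =>
    leadingCoeff_apply_eq_zero_of_lt_re (hpos Ψ hΨ f hf) hmero hreal hal hQ
      (Nat.one_le_iff_ne_zero.1 hl.1) hl.2.2.1)

theorem isResolventPole_order_le
    (hmero : MeromorphicOn (resolvent T.generator) {z | s < z.re})
    (hright : ∀ z : ℂ, s < z.re → z ∈ resolventSet T.generator)
    (hs : IsResolventPole T.generator s m) (hls : l.re = s)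
    (hl : IsResolventPole T.generator l k) : k ≤ m := by
  obtain ⟨Q, hQ0, hQ⟩ := hl.exists_isLeadingCoeff
  obtain ⟨Q₀, -, hQ₀⟩ := hs.exists_isLeadingCoeff
  by_contra! hmk
  exact hQ0 (clm_eq_zero_of_forall_apply_eq_zero hspan hsep fun Ψ hΨ f hf =>
    leadingCoeff_apply_eq_zero_of_lt_order (hpos Ψ hΨ f hf) hmero hright hQ₀ hls hmk hQ hl.2.2.1)

theorem ofReal_mem_spectrum_of_spectralBound_eq (hs : spectralBound T.generator = s)
    (hess : essentialSpectralBound T.generator < s) : (s : ℂ) ∈ spectrum T.generator := by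
  intro hsρ
  obtain ⟨α, hα, hαs⟩ := EReal.exists_between_coe_real hess
  obtain ⟨b, hbs, hb⟩ := exists_Ioc_subset_of_mem_nhds
    (Complex.continuous_ofReal.continuousAt.preimage_mem_nhds
      ((isOpen_resolventSet T.generator).mem_nhds hsρ)) ⟨α, EReal.coe_lt_coe_iff.1 hαs⟩
  have hmero := fun (z : ℂ) (hz : α < z.re) =>
    eventually_mem_resolventSet_and_meromorphicAt_resolvent_of_lt_re T.spectralBound_lt_top hα hz
  have hreal : ∀ x : ℝ, max α b < x → (x : ℂ) ∈ resolventSet T.generator := fun x hx => by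
    rcases le_or_gt x s with hxs | hsx
    · exact hb ⟨(le_max_right α b).trans_lt hx, hxs⟩
    · exact mem_resolventSet_of_spectralBound_lt (hs.trans_lt (EReal.coe_lt_coe_iff.2 hsx))
  have hlt : ((max α b : ℝ) : EReal) < spectralBound T.generator :=
    hs ▸ EReal.coe_lt_coe_iff.2 (max_lt (EReal.coe_lt_coe_iff.1 hαs) hbs)
  obtain ⟨l, hl, hal⟩ := by simpa only [spectralBound, lt_iSup_iff, exists_prop] using hlt
  rw [EReal.coe_lt_coe_iff] at hal
  obtain ⟨hev, hm⟩ := hmero l ((le_max_left α b).trans_lt hal)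
  obtain ⟨k, hk⟩ := exists_isResolventPole hl hev hm
  exact not_isResolventPole_of_lt_re hspan hsep hpos
    (fun z hz => (hmero z ((le_max_left α b).trans_lt hz)).2) hreal hal hk

end SpectralBound

theorem exists_eigenvector_mem [CompleteSpace E] {C : Set E} {𝓕 : Set (E →L[ℂ] ℂ)} {s : ℝ} {m : ℕ}
    (hspan : Dense (Submodule.span ℂ C : Set E)) (hC : ∀ z, (∀ Ψ ∈ 𝓕, 0 ≤ Ψ z) → z ∈ C)
    (hpos : ∀ Ψ ∈ 𝓕, ∀ f ∈ C, ∀ᶠ t in atTop, 0 ≤ Ψ (T.op t f))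
    (hmero : MeromorphicOn (resolvent T.generator) {z | s < z.re})
    (hreal : ∀ x : ℝ, s < x → (x : ℂ) ∈ resolventSet T.generator)
    (hs : IsResolventPole T.generator s m) :
    ∃ v : T.generator.domain, (v : E) ≠ 0 ∧ (v : E) ∈ C ∧ T.generator v = (s : ℂ) • (v : E) := by
  have hm : m ≠ 0 := Nat.one_le_iff_ne_zero.1 hs.1
  obtain ⟨Q, hQ0, hQ⟩ := hs.exists_isLeadingCoeff
  obtain ⟨f, hf, hQf⟩ : ∃ f ∈ C, Q f ≠ 0 := by
    by_contra! hcon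
    exact hQ0 (ContinuousLinearMap.ext_on hspan hcon)
  obtain ⟨v, hv, hAv⟩ := hQ.exists_eigenvector hm hs.2.2.1 f
  refine ⟨v, hv ▸ hQf, hC v fun Ψ hΨ => ?_, hAv⟩
  rw [hv]
  exact leadingCoeff_apply_nonneg (hpos Ψ hΨ f hf) hmero hreal hQ hm hs.2.2.1

end C0Semigroup

section BanachLattice

variable {F G : Type*} [NormedAddCommGroup F] [Lattice F] [HasSolidNorm F] [IsOrderedAddMonoid F]
  [NormedSpace ℝ F]

section Monotone

variable [NormedAddCommGroup G] [Lattice G] [HasSolidNorm G] [IsOrderedAddMonoid G]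
  [NormedSpace ℝ G] {f : F →ₗ[ℝ] G}

omit [HasSolidNorm F] [IsOrderedAddMonoid F] [IsOrderedAddMonoid G] in
theorem norm_apply_le_norm_apply_abs_of_monotone (hf : Monotone f) (x : F) : ‖f x‖ ≤ ‖f |x|‖ := by
  refine norm_le_norm_of_abs_le_abs ((abs_le'.2 ⟨hf (le_abs_self x), ?_⟩).trans (le_abs_self _))
  rw [← map_neg]
  exact hf (neg_le_abs x)

theorem continuous_of_monotone [CompleteSpace F] (hf : Monotone f) : Continuous f := by
  suffices ∃ C, ∀ x, ‖f x‖ ≤ C * ‖x‖ by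
    obtain ⟨C, hC⟩ := this
    exact AddMonoidHomClass.continuous_of_bound f C hC
  by_contra! hunbdd
  have hlarge (n : ℕ) : ∃ x : F, ‖x‖ < (1 / 2 : ℝ) ^ n ∧ n < ‖f x‖ := by
    by_contra! hbdd
    obtain ⟨C, hC⟩ := f.bound_of_ball_bound (r := (1 / 2 : ℝ) ^ n) (by positivity) n
      fun x hx => hbdd x (mem_ball_zero_iff.1 hx)
    obtain ⟨x, hx⟩ := hunbdd C
    exact hx.not_ge (hC x)
  choose x hxsmall hxlarge using hlarge
  have hsum : Summable fun n => |x n| := summable_geometric_two.of_norm_bounded fun n =>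
    (norm_abs_eq_norm (x n)).trans_le (hxsmall n).le
  obtain ⟨n, hn⟩ := exists_nat_gt ‖f (∑' n, |x n|)‖
  refine lt_irrefl (n : ℝ) ?_
  calc (n : ℝ) < ‖f (x n)‖ := hxlarge n
    _ ≤ ‖f |x n|‖ := norm_apply_le_norm_apply_abs_of_monotone hf (x n)
    _ ≤ ‖f (∑' n, |x n|)‖ := norm_le_norm_of_abs_le_abs <| by
      have hf0 : 0 ≤ f |x n| := (map_zero f).symm.trans_le (hf (abs_nonneg (x n)))
      have hle : f |x n| ≤ f (∑' n, |x n|) := hf (hsum.le_tsum n fun k _ => abs_nonneg (x k))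
      rwa [abs_of_nonneg hf0, abs_of_nonneg (hf0.trans hle)]
    _ < n := hn

end Monotone

theorem nonneg_of_forall_nonneg_functional [IsOrderedModule ℝ F] {x : F}
    (h : ∀ φ : F →L[ℝ] ℝ, (∀ y, 0 ≤ y → 0 ≤ φ y) → 0 ≤ φ x) : 0 ≤ x := by
  by_contra hx
  obtain ⟨φ, hφ, hφx⟩ := (ProperCone.positive ℝ F).hyperplane_separation_point (x₀ := x)
    (by simpa using hx)
  exact (h φ fun y hy => hφ y (by simpa using hy)).not_gt hφx

end BanachLattice

namespace Complexification

open scoped ComplexOrder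

section Cone

variable {F : Type*} [AddCommGroup F] [Lattice F]

theorem mk_zero_mem_positiveCone {x : F} (hx : 0 ≤ x) :
    (⟨x, 0⟩ : Complexification F) ∈ positiveCone F := ⟨hx, rfl⟩

theorem eq_zero_of_mem_positiveCone_of_neg_mem [IsOrderedAddMonoid F] {z : Complexification F}
    (hz : z ∈ positiveCone F) (hz' : -z ∈ positiveCone F) : z = 0 :=
  Complexification.ext (le_antisymm (neg_nonneg.1 hz'.1) hz.1) hz.2

theorem span_positiveCone [IsOrderedAddMonoid F] [Module ℝ F] :
    Submodule.span ℂ (positiveCone F) = ⊤ := by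
  have hmem {x : F} (hx : 0 ≤ x) : ⟨x, 0⟩ ∈ Submodule.span ℂ (positiveCone F) :=
    Submodule.subset_span (mk_zero_mem_positiveCone hx)
  refine Submodule.eq_top_iff'.2 fun z => ?_
  have hz : z = (⟨z.re⁺, 0⟩ - ⟨z.re⁻, 0⟩) + Complex.I • (⟨z.im⁺, 0⟩ - ⟨z.im⁻, 0⟩) := by
    ext <;> simp
  rw [hz]
  exact add_mem (sub_mem (hmem (posPart_nonneg _)) (hmem (negPart_nonneg _)))
    (Submodule.smul_mem _ _ (sub_mem (hmem (posPart_nonneg _)) (hmem (negPart_nonneg _))))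

end Cone

variable {F : Type*} [NormedAddCommGroup F] [Lattice F] [HasSolidNorm F] [IsOrderedAddMonoid F]
  [NormedSpace ℝ F] [IsOrderedModule ℝ F] [CompleteSpace F] {z : Complexification F}
  {S : Complexification F →ₗ[ℂ] Complexification F}
  {P : ℕ → Complexification F →ₗ[ℂ] Complexification F}

theorem continuous_re : Continuous (re : Complexification F → F) :=
  (LipschitzWith.of_dist_le_mul (K := 1) fun z w => by
    simpa only [dist_eq_norm, NNReal.coe_one, one_mul, sub_re] using norm_re_le (z - w)).continuous

theorem continuous_im : Continuous (im : Complexification F → F) :=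
  (LipschitzWith.of_dist_le_mul (K := 1) fun z w => by
    simpa only [dist_eq_norm, NNReal.coe_one, one_mul, sub_im] using norm_im_le (z - w)).continuous

theorem continuous_mk_zero : Continuous fun x : F => (⟨x, 0⟩ : Complexification F) :=
  (LipschitzWith.of_dist_le_mul (K := 1) fun x y => by
    have h : ‖(⟨x, 0⟩ : Complexification F) - ⟨y, 0⟩‖ ≤ ‖x - y‖ + ‖(0 : F) - 0‖ := norm_le_add _
    simpa only [dist_eq_norm, NNReal.coe_one, one_mul, sub_zero, norm_zero,
      add_zero] using h).continuous

theorem isClosed_positiveCone : IsClosed (positiveCone F) :=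
  (isClosed_nonneg.preimage continuous_re).inter (isClosed_singleton.preimage continuous_im)

omit [HasSolidNorm F] [IsOrderedModule ℝ F] [CompleteSpace F] in
theorem IsPositiveOperator.apply_mk_zero_im (hS : IsPositiveOperator S) (x : F) :
    (S ⟨x, 0⟩).im = 0 := by
  have hx : (⟨x, 0⟩ : Complexification F) = ⟨x⁺, 0⟩ - ⟨x⁻, 0⟩ := by ext <;> simp
  rw [hx, map_sub, sub_im, (hS _ (mk_zero_mem_positiveCone (posPart_nonneg x))).2,
    (hS _ (mk_zero_mem_positiveCone (negPart_nonneg x))).2, sub_zero]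

theorem IsPositiveOperator.continuous (hS : IsPositiveOperator S) : Continuous S := by
  let f : F →ₗ[ℝ] F :=
    { toFun := fun x => (S ⟨x, 0⟩).re
      map_add' := fun x y => by
        rw [← add_re, ← map_add]
        congr
        exact (add_zero 0).symm
      map_smul' := fun r x => by
        have hr : (⟨r • x, 0⟩ : Complexification F) = (r : ℂ) • ⟨x, 0⟩ := by
          ext <;> simp [-Complex.coe_smul]
        rw [hr, map_smul]
        simp [-Complex.coe_smul] }
  have hf : Monotone f := fun x y hxy => sub_nonneg.1 <| by
    rw [← map_sub]
    exact (hS _ (mk_zero_mem_positiveCone (sub_nonneg.2 hxy))).1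
  have hSf (x : F) : S ⟨x, 0⟩ = ⟨f x, 0⟩ := Complexification.ext rfl (hS.apply_mk_zero_im x)
  have hSz : ⇑S = fun z => ⟨f z.re, 0⟩ + Complex.I • ⟨f z.im, 0⟩ := funext fun z => by
    rw [← hSf, ← hSf, ← map_smul, ← map_add]
    congr 1
    ext <;> simp
  have hfc := continuous_of_monotone hf
  rw [hSz]
  exact (continuous_mk_zero.comp (hfc.comp continuous_re)).add
    ((continuous_mk_zero.comp (hfc.comp continuous_im)).const_smul Complex.I)

/-- The complex linear extension `x + iy ↦ φ x + i φ y` of a real functional `φ`. -/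
noncomputable def extend (φ : F →L[ℝ] ℝ) : Complexification F →L[ℂ] ℂ where
  toFun z := ⟨φ z.re, φ z.im⟩
  map_add' z w := by apply Complex.ext <;> simp
  map_smul' c z := by apply Complex.ext <;> simp
  cont := by
    simp only [Complex.mk_eq_add_mul_I]
    have := continuous_re (F := F)
    have := continuous_im (F := F)
    fun_prop

theorem extend_nonneg_iff {φ : F →L[ℝ] ℝ} : 0 ≤ extend φ z ↔ 0 ≤ φ z.re ∧ 0 = φ z.im :=
  Complex.nonneg_iff

theorem mem_positiveCone_of_forall_extend_nonneg
    (h : ∀ φ : F →L[ℝ] ℝ, (∀ y, 0 ≤ y → 0 ≤ φ y) → 0 ≤ extend φ z) : z ∈ positiveCone F := by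
  refine ⟨nonneg_of_forall_nonneg_functional fun φ hφ => (extend_nonneg_iff.1 (h φ hφ)).1,
    le_antisymm (neg_nonneg.1 ?_) ?_⟩ <;>
  refine nonneg_of_forall_nonneg_functional fun φ hφ => ?_
  · rw [map_neg, ← (extend_nonneg_iff.1 (h φ hφ)).2, neg_zero]
  · exact (extend_nonneg_iff.1 (h φ hφ)).2.le

/-- The functionals `φ ∘ Pₙ` with `n ∈ ℕ` and `φ` a positive functional on the real lattice. They
are the ones along which local eventual positivity makes orbits eventually nonnegative. -/
def testFunctionals (P : ℕ → Complexification F →ₗ[ℂ] Complexification F) :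
    Set (Complexification F →L[ℂ] ℂ) :=
  {Ψ | ∃ (n : ℕ) (φ : F →L[ℝ] ℝ), (∀ y, 0 ≤ y → 0 ≤ φ y) ∧ ∀ z, Ψ z = extend φ (P n z)}

theorem mem_positiveCone_of_forall_testFunctionals (hP : ∀ n, IsPositiveOperator (P n))
    (hlim : Tendsto (fun n => P n z) atTop (𝓝 z)) (h : ∀ Ψ ∈ testFunctionals P, 0 ≤ Ψ z) :
    z ∈ positiveCone F :=
  isClosed_positiveCone.mem_of_tendsto hlim <| .of_forall fun n =>
    mem_positiveCone_of_forall_extend_nonneg fun φ hφ =>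
      h ((extend φ).comp ⟨P n, (hP n).continuous⟩) ⟨n, φ, hφ, fun _ => rfl⟩

theorem eq_zero_of_forall_testFunctionals (hP : ∀ n, IsPositiveOperator (P n))
    (hlim : Tendsto (fun n => P n z) atTop (𝓝 z)) (h : ∀ Ψ ∈ testFunctionals P, Ψ z = 0) :
    z = 0 := by
  refine eq_zero_of_mem_positiveCone_of_neg_mem
    (mem_positiveCone_of_forall_testFunctionals hP hlim fun Ψ hΨ => (h Ψ hΨ).ge)
    (mem_positiveCone_of_forall_testFunctionals hP ?_ fun Ψ hΨ => ?_)
  · simpa only [map_neg] using hlim.neg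
  · rw [map_neg, h Ψ hΨ, neg_zero]

end Complexification

open scoped ComplexOrder in
theorem HasLEP.eventually_testFunctional_nonneg {F : Type*} [NormedAddCommGroup F] [Lattice F]
    [HasSolidNorm F] [IsOrderedAddMonoid F] [NormedSpace ℝ F] [IsOrderedModule ℝ F]
    [CompleteSpace F] {T : C0Semigroup (Complexification F)}
    {P : ℕ → Complexification F →ₗ[ℂ] Complexification F} (hLEP : HasLEP T P)
    {Ψ : Complexification F →L[ℂ] ℂ} (hΨ : Ψ ∈ Complexification.testFunctionals P)
    {f : Complexification F} (hf : f ∈ Complexification.positiveCone F) :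
    ∀ᶠ t in atTop, 0 ≤ Ψ (T.op t f) := by
  obtain ⟨n, φ, hφ, hΨφ⟩ := hΨ
  rcases eq_or_ne f 0 with rfl | hf0
  · simp only [map_zero, le_refl, eventually_true]
  · obtain ⟨τ, -, hτ⟩ := hLEP n f hf hf0
    filter_upwards [eventually_ge_atTop τ] with t ht
    obtain ⟨hre, him⟩ := hτ t ht
    rw [hΨφ, Complexification.extend_nonneg_iff, him, map_zero]
    exact ⟨hφ _ hre, rfl⟩

open UnboundedOperator in
open scoped ComplexOrder in
theorem mainTheorem4_general {E : Type*} [NormedAddCommGroup E] [NormedSpace ℂ E] [CompleteSpace E]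
    (T : C0Semigroup E) {C : Set E} {𝓕 : Set (E →L[ℂ] ℂ)}
    (hspan : Dense (Submodule.span ℂ C : Set E)) (hsep : ∀ z, (∀ Ψ ∈ 𝓕, Ψ z = 0) → z = 0)
    (hC : ∀ z, (∀ Ψ ∈ 𝓕, 0 ≤ Ψ z) → z ∈ C)
    (hpos : ∀ Ψ ∈ 𝓕, ∀ f ∈ C, ∀ᶠ t in atTop, 0 ≤ Ψ (T.op t f))
    (hess : essentialSpectralBound T.generator < spectralBound T.generator) :
    ∃ (s : ℝ) (m : ℕ), spectralBound T.generator = (s : EReal) ∧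
      IsResolventPole T.generator (s : ℂ) m ∧
      (∃ v : T.generator.domain, (v : E) ≠ 0 ∧ (v : E) ∈ C ∧
        T.generator v = (s : ℂ) • (v : E)) ∧
      ∀ (l : ℂ) (k : ℕ), l ∈ peripheralSpectrum T.generator →
        IsResolventPole T.generator l k → k ≤ m := by
  lift spectralBound T.generator to ℝ
    using ⟨T.spectralBound_lt_top.ne, (bot_le.trans_lt hess).ne'⟩ with s hs
  obtain ⟨α, hα, hαs⟩ := EReal.exists_between_coe_real hess
  rw [EReal.coe_lt_coe_iff] at hαs
  have hmero := fun (z : ℂ) (hz : α < z.re) =>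
    eventually_mem_resolventSet_and_meromorphicAt_resolvent_of_lt_re T.spectralBound_lt_top hα hz
  have hmeroOn : MeromorphicOn (resolvent T.generator) {z | s < z.re} :=
    fun z hz => (hmero z (hαs.trans hz)).2
  have hright : ∀ z : ℂ, s < z.re → z ∈ resolventSet T.generator := fun z hz =>
    mem_resolventSet_of_spectralBound_lt (hs.symm.trans_lt (EReal.coe_lt_coe_iff.2 hz))
  have hsσ := C0Semigroup.ofReal_mem_spectrum_of_spectralBound_eq hspan hsep hpos hs.symm hess
  obtain ⟨m, hm⟩ := exists_isResolventPole hsσ (hmero s hαs).1 (hmero s hαs).2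
  refine ⟨s, m, rfl, hm, C0Semigroup.exists_eigenvector_mem hspan hC hpos hmeroOn
    (fun x hx => hright x hx) hm, fun l k hl hk => ?_⟩
  exact C0Semigroup.isResolventPole_order_le hspan hsep hpos hmeroOn hright hm
    (EReal.coe_injective (hl.2.trans hs.symm)) hk

theorem mainTheorem4 {F : Type*} [NormedAddCommGroup F] [Lattice F] [HasSolidNorm F]
    [IsOrderedAddMonoid F] [NormedSpace ℝ F] [IsOrderedModule ℝ F] [CompleteSpace F]
    (T : C0Semigroup (Complexification F))
    (P : ℕ → Complexification F →ₗ[ℂ] Complexification F)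
    (hP : Complexification.IsPositiveApproximation P)
    (hLEP : HasLEP T P)
    (hess : UnboundedOperator.essentialSpectralBound T.generator
      < UnboundedOperator.spectralBound T.generator) :
    ∃ (s : ℝ) (m : ℕ),
      UnboundedOperator.spectralBound T.generator = (s : EReal) ∧
      UnboundedOperator.IsResolventPole T.generator (s : ℂ) m ∧
      (∃ v : T.generator.domain, (v : Complexification F) ≠ 0 ∧
        (v : Complexification F) ∈ Complexification.positiveCone F ∧
        T.generator v = (s : ℂ) • (v : Complexification F)) ∧
      ∀ (l : ℂ) (k : ℕ), l ∈ UnboundedOperator.peripheralSpectrum T.generator →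
        UnboundedOperator.IsResolventPole T.generator l k → k ≤ m :=
  mainTheorem4_general T (by simp [Complexification.span_positiveCone])
    (fun z => Complexification.eq_zero_of_forall_testFunctionals hP.positive (hP.tendsto_id z))
    (fun z =>
      Complexification.mem_positiveCone_of_forall_testFunctionals hP.positive (hP.tendsto_id z))
    (fun _ hΨ _ hf => hLEP.eventually_testFunctional_nonneg hΨ hf) hess
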